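/- Conventions. A convex body in a Euclidean space is a compact convex set with non-empty interior; it is centered if its barycenter is the origin. A centered convex body $K\subset\mathbb R^n$ of volume $|K|=1$ is isotropic, with isotropic constant $L_K>0$, if $\int_K\langle x,\xi\rangle^2\,dx=L_K^2$ for every $\xi\in S^{n-1}$. For a subset $A$ of an $m$-dimensional Euclidean space $E$, $|A|$ is its $m$-dimensional volume, and $$\mathrm{as}(A)=\int_{S_E}|A\cap\xi^{\perp}|\,d\sigma_E(\xi),$$ where $\sigma_E$ is the rotation invariant probability measure on the unit sphere $S_E$ of $E$ and $|A\cap \xi^\perp|$ is the volume in the subspace $\xi^\perp=\{x\in E:\langle x,\xi\rangle=0\}$, of dimension $m-1$ (a point has $0$-dimensional volume $1$). For a section $K\cap\xi^\perp$ of $K\subset\mathbb R^n$, $\mathrm{as}(K\cap\xi^\perp)$ is computed in $E=\xi^\perp$. Proposition. There exist absolute constants $c,C>0$ with the following properties. (i) For every $n\ge 1$ and every isotropic convex body $K$ in $\mathbb R^n$, $$c\,L_K^{-1}\le \mathrm{as}(K)\le C\,L_K^{-1}.$$ (ii) For every $n\ge 2$, every isotropic convex body $K$ in $\mathbb R^n$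 and every $\xi\in S^{n-1}$, $$c\,L_K^{-2}\le \mathrm{as}(K\cap\xi^\perp)\le C\,L_K^{-2}.$$ (iii) For every $n\ge 2$ and every isotropic convex body $K$ in $\mathbb R^n$, the maximum of $\mathrm{as}(K\cap\xi^\perp)$ over $\xi\in S^{n-1}$ is attained, and $$c\,L_K|K|^{1/n}\max_{\xi\in S^{n-1}}\mathrm{as}(K\cap\xi^\perp)\le \mathrm{as}(K)\le C\,L_K|K|^{1/n}\max_{\xi\in S^{n-1}}\mathrm{as}(K\cap\xi^\perp).$$ (iv) (Sharpness.) Let $n\ge 2$ and let $\gamma>0$ be such that $\mathrm{as}(K)\le\gamma\,|K|^{1/n}\max_{\xi\in S^{n-1}}\mathrm{as}(K\cap\xi^\perp)$ for every centered convex body $K$ in $\mathbb R^n$. Then $\gamma\ge c\,L_K$ for every isotropic convex body $K$ in $\mathbb R^n$. -/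

import Mathlib

open MeasureTheory Metric Set

noncomputable section

section General

variable {E : Type*} [NormedAddCommGroup E] [InnerProductSpace ℝ E] [FiniteDimensional ℝ E]
  [MeasurableSpace E] [BorelSpace E]

/-- The volume `|A|` of a subset of a Euclidean space `E`, in the dimension of `E`: Lebesgue measure,
normalized so that a unit cube spanned by an orthonormal basis has volume one. -/
def vol (A : Set E) : ℝ := (volume : Measure E).real A

/-- The rotation invariant probability measure `σ` on the unit sphere of `E`. -/
def sphereProb (E : Type*) [NormedAddCommGroup E] [InnerProductSpace ℝ E] [FiniteDimensional ℝ E]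
    [MeasurableSpace E] [BorelSpace E] : Measure (sphere (0 : E) 1) :=
  ((volume : Measure E).toSphere univ)⁻¹ • (volume : Measure E).toSphere

/-- The subspace `ξ^⊥` of `E`. -/
abbrev perp (ξ : E) : Submodule ℝ E := (Submodule.span ℝ {ξ})ᗮ

/-- The central section `K ∩ ξ^⊥`, as a subset of the Euclidean space `ξ^⊥`. -/
def sect (K : Set E) (ξ : E) : Set (perp ξ) := {x | (x : E) ∈ K}

/-- The average section functional `as(K) = ∫ |K ∩ ξ^⊥| dσ(ξ)`. -/
def avgSection (K : Set E) : ℝ :=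
  ∫ ξ : sphere (0 : E) 1, vol (sect K (ξ : E)) ∂(sphereProb E)

/-- `max_ξ as(K ∩ ξ^⊥)`, written as a supremum over the unit sphere. -/
def maxAvgSection (K : Set E) : ℝ :=
  ⨆ ξ : sphere (0 : E) 1, avgSection (sect K (ξ : E))

/-- A convex body: a compact convex set with non-empty interior. -/
structure IsConvexBody (K : Set E) : Prop where
  isCompact : IsCompact K
  convex : Convex ℝ K
  interior_nonempty : (interior K).Nonempty

/-- A centered convex body: its barycenter `|K|⁻¹ ∫_K x dx` is the origin. -/
structure IsCenteredConvexBody (K : Set E) : Prop extends IsConvexBody K where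
  barycenter_eq_zero : (vol K)⁻¹ • ∫ x in K, x = 0

/-- `K` is an isotropic convex body with isotropic constant `L_K = L`. -/
structure IsIsotropicWith (K : Set E) (L : ℝ) : Prop extends IsCenteredConvexBody K where
  vol_eq_one : vol K = 1
  pos : 0 < L
  second_moment : ∀ ξ ∈ sphere (0 : E) 1, ∫ x in K, (inner ℝ x ξ) ^ 2 = L ^ 2

end General

end

open scoped ENNReal Pointwise Topology

/-! In the orthogonal splitting of the space into a subspace `F` and its complement, the central
section by the complement is the value at `0` of the marginal density of `K` on `F`. For isotropic
`K` this marginal `g` is a log-concave probability density, by Brunn–Minkowski on the fibres, with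
barycenter `0` and covariance `L²` times the identity. Everything follows from `g 0 ≈ L^(-d)` with
constants depending only on `d = dim F`. Only `d = 1` (sections of `K`) and `d = 2` (sections of
sections) occur, so the constants are absolute. Averaging over the sphere gives (i) and (ii);
combining these gives (iii) and (iv).

The lower bound, `exists_pos_le_mul_pow`, is an entropy comparison. Log-concavity bounds `log g` by
`log (g 0)` plus a linear function, which integrates to zero; Gibbs' inequality against a fixed
density rescaled by `L` then bounds `g 0` from below.

The upper bound, `exists_mul_pow_le`, holds because `g ≥ q * g 0` on a ball of radius of order `L`,
and `g` has mass one. The claim on the ball is `exists_forall_mul_le`. If it failed, separation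
would give a half-space close to the origin on which `g` is small. The variance on that side is then
small, and so is the first moment there; by centering, so is the first moment on the other side, and
the lower bound for the one-dimensional marginal makes the variance small there too. This
contradicts total variance `L²`.

Attainment of the maximum comes from upper semicontinuity: half-turns move the varying hyperplanes
to a fixed one, where a reverse Fatou argument applies. -/

/-! ### Brunn–Minkowski and Prékopa–Leindler on the line. -/

/-- The translates `A + min B` and `max A + B` both lie in `A + B` and meet only at `max A + min B`.
-/
theorem volume_add_volume_le_of_isCompact {A B : Set ℝ} (hA : IsCompact A) (hB : IsCompact B)
    (hA' : A.Nonempty) (hB' : B.Nonempty) : volume A + volume B ≤ volume (A + B) := by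
  obtain ⟨a, ha, haA⟩ := hA.exists_isGreatest hA'
  obtain ⟨b, hb, hbB⟩ := hB.exists_isLeast hB'
  have h1 : volume ((fun x => x + b) '' A) = volume A := by simp
  have h2 : volume ((fun x => a + x) '' B) = volume B := by simp
  have hm : MeasurableSet ((fun x => a + x) '' B) :=
    (hB.image (continuous_const.add continuous_id)).measurableSet
  have hd : AEDisjoint volume ((fun x => x + b) '' A) ((fun x => a + x) '' B) := by
    refine measure_mono_null (t := {a + b}) ?_ (by simp)
    rintro _ ⟨⟨x, hx, rfl⟩, ⟨y, hy, hxy⟩⟩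
    have := haA hx
    have := hbB hy
    simp only [mem_singleton_iff] at *
    linarith
  rw [← h1, ← h2, ← measure_union₀ hm.nullMeasurableSet hd]
  refine measure_mono ?_
  rintro _ (⟨x, hx, rfl⟩ | ⟨x, hx, rfl⟩)
  · exact add_mem_add hx hb
  · exact add_mem_add ha hx

theorem volume_eq_iSup_nonempty_isCompact {A : Set ℝ} (hA : MeasurableSet A) (hA' : A.Nonempty) :
    volume A = ⨆ K : {K : Set ℝ // K ⊆ A ∧ IsCompact K ∧ K.Nonempty}, volume K.1 := by
  obtain ⟨x, hx⟩ := hA'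
  refine le_antisymm ?_ (iSup_le fun K => measure_mono K.2.1)
  refine le_of_forall_lt fun r hr => ?_
  obtain ⟨K, hKA, hK, hrK⟩ := hA.exists_lt_isCompact hr
  -- Adjoining a point of `A` keeps the approximating compact set non-empty.
  refine hrK.trans_le ((measure_mono subset_union_left).trans
    (le_iSup (fun K : {K : Set ℝ // K ⊆ A ∧ IsCompact K ∧ K.Nonempty} => volume K.1)
      ⟨K ∪ {x}, union_subset hKA (by simpa using hx), hK.union isCompact_singleton, x, by simp⟩))

/-- The one-dimensional Brunn–Minkowski inequality. -/
theorem ofReal_mul_volume_add_le {A B C : Set ℝ} (hA : MeasurableSet A) (hB : MeasurableSet B)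
    (hA' : A.Nonempty) (hB' : B.Nonempty) {a b : ℝ} (ha : 0 < a) (hb : 0 < b)
    (h : ∀ x ∈ A, ∀ y ∈ B, a * x + b * y ∈ C) :
    ENNReal.ofReal a * volume A + ENNReal.ofReal b * volume B ≤ volume C := by
  obtain ⟨x, hx⟩ := hA'
  obtain ⟨y, hy⟩ := hB'
  have : Nonempty {K : Set ℝ // K ⊆ A ∧ IsCompact K ∧ K.Nonempty} :=
    ⟨{x}, by simpa using hx, isCompact_singleton, x, rfl⟩
  have : Nonempty {K : Set ℝ // K ⊆ B ∧ IsCompact K ∧ K.Nonempty} :=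
    ⟨{y}, by simpa using hy, isCompact_singleton, y, rfl⟩
  rw [volume_eq_iSup_nonempty_isCompact hA ⟨x, hx⟩, volume_eq_iSup_nonempty_isCompact hB ⟨y, hy⟩,
    ENNReal.mul_iSup, ENNReal.mul_iSup]
  refine ENNReal.iSup_add_iSup_le fun K K' => ?_
  have h1 : ∀ (c : ℝ) (_ : 0 < c) (S : Set ℝ), ENNReal.ofReal c * volume S = volume (c • S) := by
    intro c hc S
    rw [Measure.addHaar_smul, Module.finrank_self, pow_one, abs_of_pos hc]
  rw [h1 a ha, h1 b hb]
  refine (volume_add_volume_le_of_isCompact (K.2.2.1.smul a) (K'.2.2.1.smul b)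
    (K.2.2.2.smul_set) (K'.2.2.2.smul_set)).trans (measure_mono ?_)
  rintro _ ⟨_, ⟨x, hx, rfl⟩, _, ⟨y, hy, rfl⟩, rfl⟩
  exact h x (K.2.1 hx) y (K'.2.1 hy)

theorem lintegral_eq_lintegral_Ioo_of_le_one {f : ℝ → ℝ≥0∞} (hf : Measurable f) (h1 : ∀ x, f x ≤ 1) :
    ∫⁻ x, f x = ∫⁻ s in Ioo (0 : ℝ) 1, volume {x | ENNReal.ofReal s < f x} := by
  have h2 : ∀ x, f x ≠ ∞ := fun x => ((h1 x).trans_lt ENNReal.one_lt_top).ne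
  have h3 : ∫⁻ x, f x = ∫⁻ x, ENNReal.ofReal (f x).toReal := by simp [h2]
  rw [h3, lintegral_eq_lintegral_meas_lt _ (ae_of_all _ fun x => ENNReal.toReal_nonneg)
    hf.ennreal_toReal.aemeasurable, ← lintegral_indicator measurableSet_Ioi,
    ← lintegral_indicator measurableSet_Ioo]
  refine lintegral_congr_ae ?_
  have : ∀ᵐ s : ℝ, s ≠ 1 := by simp [ae_iff]
  filter_upwards [this] with s hs
  by_cases h0 : 0 < s
  · rw [indicator_of_mem (show s ∈ Ioi 0 from h0)]
    by_cases hs1 : s < 1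
    · rw [indicator_of_mem (show s ∈ Ioo 0 1 from ⟨h0, hs1⟩)]
      congr 1
      ext x
      simp only [mem_ofPred_eq]
      rw [ENNReal.ofReal_lt_iff_lt_toReal h0.le (h2 x)]
    · rw [indicator_of_notMem (fun h => hs1 h.2)]
      have : {x | s < (f x).toReal} = ∅ := by
        ext x
        have := ENNReal.toReal_mono ENNReal.one_ne_top (h1 x)
        simp only [ENNReal.toReal_one] at this
        simp only [mem_ofPred_eq, mem_empty_iff_false, iff_false, not_lt]
        linarith [not_lt.1 hs1]
      simp [this]
  · rw [indicator_of_notMem (show s ∉ Ioi 0 from h0), indicator_of_notMem (fun h => h0 h.1)]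

/-- With both suprema equal to `1`, the superlevel sets of `f` and `g` are non-empty at every level
`s < 1`, so one-dimensional Brunn–Minkowski applies level by level. Truncating `h` at `1` lets its
layer-cake integral run over the same levels. -/
theorem ofReal_mul_lintegral_add_le {f g h : ℝ → ℝ≥0∞} (hf : Measurable f) (hg : Measurable g)
    (hh : Measurable h) {a b : ℝ} (ha : 0 < a) (hb : 0 < b) (hab : a + b = 1)
    (H : ∀ x y, f x ^ a * g y ^ b ≤ h (a * x + b * y)) (hf1 : ⨆ x, f x = 1) (hg1 : ⨆ x, g x = 1) :
    ENNReal.ofReal a * (∫⁻ x, f x) + ENNReal.ofReal b * (∫⁻ x, g x) ≤ ∫⁻ x, h x := by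
  have hf2 : ∀ x, f x ≤ 1 := fun x => hf1 ▸ le_iSup f x
  have hg2 : ∀ x, g x ≤ 1 := fun x => hg1 ▸ le_iSup g x
  have hm : Measurable fun x => min (h x) 1 := hh.min measurable_const
  refine le_trans ?_ (lintegral_mono (fun x => min_le_left (h x) 1))
  rw [lintegral_eq_lintegral_Ioo_of_le_one hf hf2, lintegral_eq_lintegral_Ioo_of_le_one hg hg2,
    lintegral_eq_lintegral_Ioo_of_le_one hm fun x => min_le_right _ _,
    ← lintegral_const_mul' _ _ ENNReal.ofReal_ne_top, ← lintegral_const_mul' _ _ ENNReal.ofReal_ne_top]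
  refine (le_lintegral_add _ _).trans (setLIntegral_mono' measurableSet_Ioo fun s hs => ?_)
  have hs1 : ENNReal.ofReal s < 1 := by rw [← ENNReal.ofReal_one]; exact (ENNReal.ofReal_lt_ofReal_iff one_pos).2 hs.2
  refine ofReal_mul_volume_add_le (measurableSet_lt measurable_const hf)
    (measurableSet_lt measurable_const hg) ?_ ?_ ha hb ?_
  · obtain ⟨x, hx⟩ := lt_iSup_iff.1 (hf1.symm ▸ hs1)
    exact ⟨x, hx⟩
  · obtain ⟨x, hx⟩ := lt_iSup_iff.1 (hg1.symm ▸ hs1)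
    exact ⟨x, hx⟩
  · intro x hx y hy
    refine lt_min ?_ hs1
    refine lt_of_lt_of_le ?_ (H x y)
    calc ENNReal.ofReal s = ENNReal.ofReal s ^ a * ENNReal.ofReal s ^ b := by
          rw [← ENNReal.rpow_add _ _ (by simpa using hs.1) ENNReal.ofReal_ne_top, hab, ENNReal.rpow_one]
      _ < _ := ENNReal.mul_lt_mul (ENNReal.rpow_lt_rpow hx ha) (ENNReal.rpow_lt_rpow hy hb)

theorem ENNReal.rpow_mul_rpow_le_ofReal_mul_add {a b : ℝ} (ha : 0 < a) (hb : 0 < b) (hab : a + b = 1)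
    (x y : ℝ≥0∞) : x ^ a * y ^ b ≤ ENNReal.ofReal a * x + ENNReal.ofReal b * y := by
  by_cases hx : x = ∞
  · simp [hx, ENNReal.mul_top, ha]
  by_cases hy : y = ∞
  · simp [hy, ENNReal.mul_top, hb]
  lift x to NNReal using hx
  lift y to NNReal using hy
  rw [← ENNReal.coe_rpow_of_nonneg _ ha.le, ← ENNReal.coe_rpow_of_nonneg _ hb.le]
  have := NNReal.geom_mean_le_arith_mean2_weighted a.toNNReal b.toNNReal x y
    (by rw [← Real.toNNReal_add ha.le hb.le, hab, Real.toNNReal_one])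
  rw [Real.coe_toNNReal _ ha.le, Real.coe_toNNReal _ hb.le] at this
  simp only [ENNReal.ofReal]
  exact_mod_cast this

/-- Dividing by the suprema reduces to the normalized additive inequality; weighted AM–GM turns the
sum into a product, and the product form is homogeneous, so the normalization cancels. -/
theorem prekopa_leindler_of_iSup_ne_top {f g h : ℝ → ℝ≥0∞} (hf : Measurable f) (hg : Measurable g)
    (hh : Measurable h) {a b : ℝ} (ha : 0 < a) (hb : 0 < b) (hab : a + b = 1)
    (H : ∀ x y, f x ^ a * g y ^ b ≤ h (a * x + b * y)) (hf1 : ⨆ x, f x ≠ ∞) (hg1 : ⨆ x, g x ≠ ∞) :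
    (∫⁻ x, f x) ^ a * (∫⁻ x, g x) ^ b ≤ ∫⁻ x, h x := by
  set M := ⨆ x, f x with hM
  set N := ⨆ x, g x with hN
  by_cases hM0 : M = 0
  · have : ∀ x, f x = 0 := fun x => le_antisymm (hM0 ▸ le_iSup f x) zero_le
    simp [this, ha]
  by_cases hN0 : N = 0
  · have : ∀ x, g x = 0 := fun x => le_antisymm (hN0 ▸ le_iSup g x) zero_le
    simp [this, hb]
  have e1 : ∀ (P : ℝ≥0∞), P ≠ 0 → P ≠ ∞ → ∀ c : ℝ, P⁻¹ ^ c * P ^ c = 1 := by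
    intro P h0 h1 c
    rw [ENNReal.inv_rpow, ENNReal.inv_mul_cancel (by simp [h0, h1]) (by simp [h0, h1])]
  have key := ofReal_mul_lintegral_add_le (f := fun x => M⁻¹ * f x) (g := fun x => N⁻¹ * g x)
    (h := fun x => (M⁻¹ ^ a * N⁻¹ ^ b) * h x) (hf.const_mul _) (hg.const_mul _) (hh.const_mul _)
    ha hb hab ?_ ?_ ?_
  · have k2 := (ENNReal.rpow_mul_rpow_le_ofReal_mul_add ha hb hab _ _).trans key
    rw [lintegral_const_mul _ hf, lintegral_const_mul _ hg, lintegral_const_mul _ hh,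
      ENNReal.mul_rpow_of_nonneg _ _ ha.le, ENNReal.mul_rpow_of_nonneg _ _ hb.le] at k2
    have k3 : (M ^ a * N ^ b) * (M⁻¹ ^ a * (∫⁻ x, f x) ^ a * (N⁻¹ ^ b * (∫⁻ x, g x) ^ b)) ≤
      (M ^ a * N ^ b) * (M⁻¹ ^ a * N⁻¹ ^ b * ∫⁻ x, h x) := by gcongr
    calc _ = (M⁻¹ ^ a * M ^ a) * (N⁻¹ ^ b * N ^ b) * ((∫⁻ x, f x) ^ a * (∫⁻ x, g x) ^ b) := by
            rw [e1 M hM0 hf1, e1 N hN0 hg1]; simp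
      _ = _ := by ring
      _ ≤ _ := k3
      _ = (M⁻¹ ^ a * M ^ a) * (N⁻¹ ^ b * N ^ b) * ∫⁻ x, h x := by ring
      _ = _ := by rw [e1 M hM0 hf1, e1 N hN0 hg1]; simp
  · intro x y
    rw [ENNReal.mul_rpow_of_nonneg _ _ ha.le, ENNReal.mul_rpow_of_nonneg _ _ hb.le,
      mul_mul_mul_comm]
    gcongr
    exact H x y
  · rw [← ENNReal.mul_iSup]; exact ENNReal.inv_mul_cancel hM0 hf1
  · rw [← ENNReal.mul_iSup]; exact ENNReal.inv_mul_cancel hN0 hg1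

/-! ### Prékopa–Leindler and Brunn–Minkowski in Euclidean spaces. -/

/-- The Prékopa–Leindler inequality holds in the measure space `X`. -/
def HasPrekopaLeindler (X : Type*) [AddCommGroup X] [Module ℝ X] [MeasureSpace X] : Prop :=
  ∀ ⦃a b : ℝ⦄, 0 < a → 0 < b → a + b = 1 → ∀ ⦃f g h : X → ℝ≥0∞⦄, Measurable f → Measurable g →
    Measurable h → (∀ x y, f x ^ a * g y ^ b ≤ h (a • x + b • y)) →
    (∫⁻ x, f x) ^ a * (∫⁻ x, g x) ^ b ≤ ∫⁻ x, h x

theorem lintegral_eq_iSup_lintegral_min {X : Type*} [MeasureSpace X] {f : X → ℝ≥0∞}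
    (hf : Measurable f) : ∫⁻ x, f x = ⨆ n : ℕ, ∫⁻ x, min (f x) n := by
  rw [← lintegral_iSup (fun n => hf.min measurable_const)
    (fun m n hmn x => min_le_min_left _ (by exact_mod_cast hmn))]
  refine lintegral_congr fun x => ?_
  rw [← inf_iSup_eq, ENNReal.iSup_natCast, inf_top_eq]

theorem hasPrekopaLeindler_real : HasPrekopaLeindler ℝ := by
  intro a b ha hb hab f g h hf hg hh H
  rw [lintegral_eq_iSup_lintegral_min hf, lintegral_eq_iSup_lintegral_min hg]
  have e : ∀ (c : ℝ) (_ : 0 < c) (u : ℕ → ℝ≥0∞), (⨆ n, u n) ^ c = ⨆ n, u n ^ c := fun c hc u =>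
    (ENNReal.orderIsoRpow c hc).map_iSup u
  rw [e a ha, e b hb]
  simp only [ENNReal.iSup_mul, ENNReal.mul_iSup]
  refine iSup_le fun n => iSup_le fun m => ?_
  refine prekopa_leindler_of_iSup_ne_top (hf.min measurable_const) (hg.min measurable_const) hh
    ha hb hab (fun x y => le_trans ?_ (H x y)) ?_ ?_
  · gcongr <;> exact min_le_left _ _
  · exact ((iSup_le fun x => min_le_right _ _).trans_lt (ENNReal.natCast_lt_top m)).ne
  · exact ((iSup_le fun x => min_le_right _ _).trans_lt (ENNReal.natCast_lt_top n)).ne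

section PrekopaLeindler

variable {X Y : Type*} [AddCommGroup X] [Module ℝ X] [MeasureSpace X]
  [AddCommGroup Y] [Module ℝ Y] [MeasureSpace Y]

/-- The inequality on the fibres `Y` is precisely the hypothesis needed to apply it on `X` to the
fibre integrals. -/
theorem HasPrekopaLeindler.prod [SFinite (volume : Measure Y)] (hX : HasPrekopaLeindler X)
    (hY : HasPrekopaLeindler Y) : HasPrekopaLeindler (X × Y) := by
  intro a b ha hb hab f g h hf hg hh H
  rw [Measure.volume_eq_prod, lintegral_prod _ hf.aemeasurable, lintegral_prod _ hg.aemeasurable,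
    lintegral_prod _ hh.aemeasurable]
  refine hX ha hb hab hf.lintegral_prod_right' hg.lintegral_prod_right' hh.lintegral_prod_right' ?_
  intro x x'
  exact hY ha hb hab (hf.comp measurable_prodMk_left) (hg.comp measurable_prodMk_left)
    (hh.comp measurable_prodMk_left) fun y y' => H (x, y) (x', y')

theorem HasPrekopaLeindler.of_measurePreserving (hX : HasPrekopaLeindler X) (e : X →ₗ[ℝ] Y)
    (he : MeasurePreserving e) : HasPrekopaLeindler Y := by
  intro a b ha hb hab f g h hf hg hh H
  rw [← he.lintegral_comp hf, ← he.lintegral_comp hg, ← he.lintegral_comp hh]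
  refine hX ha hb hab (hf.comp he.measurable) (hg.comp he.measurable) (hh.comp he.measurable) ?_
  intro x y
  rw [map_add, map_smul, map_smul]
  exact H _ _

end PrekopaLeindler

theorem hasPrekopaLeindler_pi : ∀ n : ℕ, HasPrekopaLeindler (Fin n → ℝ)
  | 0 => by
    intro a b ha hb hab f g h hf hg hh H
    rw [Measure.volume_pi_eq_dirac 0, lintegral_dirac, lintegral_dirac, lintegral_dirac]
    simpa using H 0 0
  | n + 1 => by
    refine (hasPrekopaLeindler_real.prod (hasPrekopaLeindler_pi n)).of_measurePreserving
      { toFun := (MeasurableEquiv.piFinSuccAbove (fun _ : Fin (n + 1) => ℝ) 0).symm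
        map_add' := fun x y => ?_
        map_smul' := fun c x => ?_ }
      (volume_preserving_piFinSuccAbove (fun _ : Fin (n + 1) => ℝ) 0).symm
    · ext i; refine Fin.cases ?_ (fun j => ?_) i <;> simp [MeasurableEquiv.piFinSuccAbove, Fin.insertNthEquiv]
    · ext i; refine Fin.cases ?_ (fun j => ?_) i <;> simp [MeasurableEquiv.piFinSuccAbove, Fin.insertNthEquiv]

section InnerProduct

variable {G : Type*} [NormedAddCommGroup G] [InnerProductSpace ℝ G] [FiniteDimensional ℝ G]
  [MeasurableSpace G] [BorelSpace G]

theorem hasPrekopaLeindler_innerProductSpace : HasPrekopaLeindler G := by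
  refine (hasPrekopaLeindler_pi (Module.finrank ℝ G)).of_measurePreserving
    ((stdOrthonormalBasis ℝ G).repr.symm.toLinearEquiv.toLinearMap ∘ₗ
      (WithLp.linearEquiv 2 ℝ (Fin (Module.finrank ℝ G) → ℝ)).symm.toLinearMap) ?_
  exact (stdOrthonormalBasis ℝ G).measurePreserving_repr_symm.comp
    (PiLp.volume_preserving_toLp (Fin (Module.finrank ℝ G)))

/-- The multiplicative form of the Brunn–Minkowski inequality. -/
theorem measure_rpow_mul_measure_rpow_le {A B C : Set G} (hA : MeasurableSet A)
    (hB : MeasurableSet B) (hC : MeasurableSet C) {a b : ℝ} (ha : 0 < a) (hb : 0 < b)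
    (hab : a + b = 1) (h : ∀ x ∈ A, ∀ y ∈ B, a • x + b • y ∈ C) :
    volume A ^ a * volume B ^ b ≤ volume C := by
  have := hasPrekopaLeindler_innerProductSpace ha hb hab
    (measurable_const.indicator hA : Measurable (A.indicator fun _ => (1 : ℝ≥0∞)))
    (measurable_const.indicator hB : Measurable (B.indicator fun _ => (1 : ℝ≥0∞)))
    (measurable_const.indicator hC : Measurable (C.indicator fun _ => (1 : ℝ≥0∞))) ?_
  · simpa [lintegral_indicator, hA, hB, hC] using this
  · intro x y
    by_cases hx : x ∈ A
    · by_cases hy : y ∈ B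
      · simp [hx, hy, h x hx y hy]
      · simp [hy, hb]
    · simp [hx, ha]

end InnerProduct

/-! ### Isotropic log-concave densities and their value at the origin. -/

/-- `g` is the density, with respect to `μ`, of an upper semicontinuous log-concave probability
measure with bounded support, barycenter `0` and covariance `L²` times the identity. -/
structure IsLogConcaveDensity {F : Type*} [NormedAddCommGroup F] [InnerProductSpace ℝ F]
    [MeasurableSpace F] (μ : Measure F) (g : F → ℝ) (L : ℝ) : Prop where
  pos : 0 < L
  nonneg : ∀ u, 0 ≤ g u
  isClosed_le : ∀ r, IsClosed {u | r ≤ g u}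
  bounded : ∃ R, ∀ u, g u ≠ 0 → ‖u‖ ≤ R
  integrable : Integrable g μ
  rpow_mul_rpow_le : ∀ (u v : F) (a b : ℝ), 0 < a → 0 < b → a + b = 1 →
    g u ^ a * g v ^ b ≤ g (a • u + b • v)
  pos_near : ∃ r > 0, ∀ u, ‖u‖ < r → 0 < g u
  integral_eq_one : ∫ u, g u ∂μ = 1
  integral_inner : ∀ θ, ∫ u, inner ℝ θ u * g u ∂μ = 0
  integral_inner_sq : ∀ θ, ‖θ‖ = 1 → ∫ u, inner ℝ θ u ^ 2 * g u ∂μ = L ^ 2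

namespace IsLogConcaveDensity

variable {F : Type*} [NormedAddCommGroup F] [InnerProductSpace ℝ F]
  [MeasurableSpace F] {μ : Measure F} {g : F → ℝ} {L : ℝ}

theorem zero_pos (h : IsLogConcaveDensity μ g L) : 0 < g 0 := by
  obtain ⟨r, hr, h'⟩ := h.pos_near
  exact h' 0 (by simpa using hr)

theorem min_le (h : IsLogConcaveDensity μ g L) (u v : F) {a b : ℝ} (ha : 0 < a) (hb : 0 < b)
    (hab : a + b = 1) : min (g u) (g v) ≤ g (a • u + b • v) := by
  have h0 : 0 ≤ min (g u) (g v) := le_min (h.nonneg u) (h.nonneg v)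
  calc min (g u) (g v) = min (g u) (g v) ^ a * min (g u) (g v) ^ b := by
        rw [← Real.rpow_add_of_nonneg h0 ha.le hb.le, hab, Real.rpow_one]
    _ ≤ g u ^ a * g v ^ b := by
        gcongr
        · exact Real.rpow_nonneg (h.nonneg u) _
        · exact min_le_left _ _
        · exact min_le_right _ _
    _ ≤ _ := h.rpow_mul_rpow_le u v a b ha hb hab

theorem convex_le (h : IsLogConcaveDensity μ g L) (r : ℝ) : Convex ℝ {u | r ≤ g u} :=
  convex_iff_forall_pos.2 fun u hu v hv _ _ ha hb hab =>
    (le_min hu hv).trans (h.min_le u v ha hb hab)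

theorem convex_lt (h : IsLogConcaveDensity μ g L) (r : ℝ) : Convex ℝ {u | r < g u} :=
  convex_iff_forall_pos.2 fun u hu v hv _ _ ha hb hab =>
    (lt_min hu hv).trans_le (h.min_le u v ha hb hab)

theorem log_add_log_le (h : IsLogConcaveDensity μ g L) {u v : F} (hu : 0 < g u) (hv : 0 < g v)
    {a b : ℝ} (ha : 0 < a) (hb : 0 < b) (hab : a + b = 1) :
    a * Real.log (g u) + b * Real.log (g v) ≤ Real.log (g (a • u + b • v)) := by
  rw [← Real.log_rpow hu, ← Real.log_rpow hv, ← Real.log_mul (by positivity) (by positivity)]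
  exact Real.log_le_log (by positivity) (h.rpow_mul_rpow_le u v a b ha hb hab)

theorem zero_mem_interior (h : IsLogConcaveDensity μ g L) : (0 : F) ∈ interior {u | 0 < g u} := by
  obtain ⟨r, hr, h'⟩ := h.pos_near
  exact mem_interior.2 ⟨ball 0 r, fun u hu => h' u (by simpa using hu), isOpen_ball,
    mem_ball_self hr⟩

theorem concaveOn_log (h : IsLogConcaveDensity μ g L) :
    ConcaveOn ℝ (interior {u | 0 < g u}) fun u => Real.log (g u) := by
  refine concaveOn_iff_forall_pos.2 ⟨(h.convex_lt 0).interior, fun u hu v hv a b ha hb hab => ?_⟩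
  exact h.log_add_log_le (show u ∈ {u | 0 < g u} from interior_subset hu)
    (show v ∈ {u | 0 < g u} from interior_subset hv) ha hb hab

variable [FiniteDimensional ℝ F] [BorelSpace F]

theorem integrable_mul (h : IsLogConcaveDensity μ g L) {φ : F → ℝ} (hφ : Continuous φ) :
    Integrable (fun u => φ u * g u) μ := by
  obtain ⟨R, hR⟩ := h.bounded
  obtain ⟨C, hC⟩ := (isCompact_closedBall (0 : F) R).exists_bound_of_continuousOn hφ.continuousOn
  refine Integrable.mono' (h.integrable.const_mul C)
    (hφ.aestronglyMeasurable.mul h.integrable.aestronglyMeasurable) (ae_of_all _ fun u => ?_)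
  by_cases hu : g u = 0
  · simp [hu]
  · rw [norm_mul, Real.norm_of_nonneg (h.nonneg u)]
    exact mul_le_mul_of_nonneg_right (hC u (by simpa using hR u hu)) (h.nonneg u)

omit [BorelSpace F] in
/-- A log-concave density has an exponential majorant touching it at the origin. -/
theorem exists_le_mul_exp (h : IsLogConcaveDensity μ g L) :
    ∃ θ : F, ∀ u, 0 < g u → Real.log (g u) ≤ Real.log (g 0) + inner ℝ θ u := by
  set U := interior {u | 0 < g u} with hU
  have h0 : (0 : F) ∈ U := h.zero_mem_interior
  have hconv := h.concaveOn_log.convex_strict_hypograph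
  have hopen : IsOpen {p : F × ℝ | p.1 ∈ U ∧ p.2 < Real.log (g p.1)} := by
    have hc : ContinuousOn (fun p : F × ℝ => Real.log (g p.1) - p.2) (U ×ˢ univ) :=
      ((h.concaveOn_log.continuousOn isOpen_interior).comp continuousOn_fst
        fun p hp => hp.1).sub continuousOn_snd
    have := hc.isOpen_inter_preimage (isOpen_interior.prod isOpen_univ) (isOpen_Ioi (a := 0))
    convert this using 1
    ext p
    simp [sub_pos]
  -- The supporting hyperplane of the strict hypograph at `(0, log (g 0))`; it is not vertical
  -- because `0` is interior to the support.
  obtain ⟨f, hf⟩ := geometric_hahn_banach_open_point hconv hopen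
    (x := ((0 : F), Real.log (g 0))) (by simp)
  have hsplit : ∀ (u : F) (s : ℝ), f (u, s) = f (u, 0) + s * f (0, 1) := by
    intro u s
    rw [← smul_eq_mul, ← map_smul, ← map_add]
    simp
  set c := f (0, 1) with hc
  have hc0 : 0 < c := by
    have := hf (0, Real.log (g 0) - 1) ⟨h0, by simp⟩
    rw [hsplit, hsplit 0 (Real.log (g 0))] at this
    linarith
  set ℓ : F →L[ℝ] ℝ := (-c⁻¹) • (f.comp (ContinuousLinearMap.inl ℝ F ℝ)) with hℓ
  have hint : ∀ u ∈ U, Real.log (g u) ≤ Real.log (g 0) + ℓ u := by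
    intro u hu
    refine le_of_forall_lt fun s hs => ?_
    have := hf (u, s) ⟨hu, hs⟩
    rw [hsplit, hsplit 0 (Real.log (g 0))] at this
    have h00 : f (0, 0) = 0 := map_zero f
    have e : ℓ u = -(c⁻¹ * f (u, 0)) := by simp [hℓ]
    rw [h00, zero_add] at this
    have h3 := mul_lt_mul_of_pos_left this (inv_pos.2 hc0)
    have e2 : ∀ s, c⁻¹ * (s * c) = s := fun s => by field_simp
    rw [mul_add, e2, e2] at h3
    rw [e]
    linarith
  refine ⟨(InnerProductSpace.toDual ℝ F).symm ℓ, fun u hu => ?_⟩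
  rw [InnerProductSpace.toDual_symm_apply]
  -- The linear bound is known only in the interior of the support. For a general `u` in the support
  -- the midpoint of `u` and `0` is interior, and log-concavity carries the bound from it to `u`.
  have hm : (1 / 2 : ℝ) • u + (1 / 2 : ℝ) • (0 : F) ∈ U := by
    rw [add_comm]
    exact (h.convex_lt 0).combo_interior_self_mem_interior h0 hu (by norm_num) (by norm_num)
      (by norm_num)
  have h1 := hint _ hm
  have h2 := h.log_add_log_le hu h.zero_pos (a := 1 / 2) (b := 1 / 2) (by norm_num) (by norm_num)
    (by norm_num)
  rw [smul_zero, add_zero] at h1 h2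
  rw [map_smul, smul_eq_mul] at h1
  linarith

theorem integral_norm_sq (h : IsLogConcaveDensity μ g L) :
    ∫ u, ‖u‖ ^ 2 * g u ∂μ = Module.finrank ℝ F * L ^ 2 := by
  have e : ∀ u : F, ‖u‖ ^ 2 * g u = ∑ i, inner ℝ (stdOrthonormalBasis ℝ F i) u ^ 2 * g u := by
    intro u
    rw [← Finset.sum_mul, ← (stdOrthonormalBasis ℝ F).sum_sq_norm_inner_right u]
    simp
  simp_rw [e]
  rw [integral_finsetSum _ fun i _ => h.integrable_mul (by fun_prop)]
  simp_rw [h.integral_inner_sq _ ((stdOrthonormalBasis ℝ F).norm_eq_one _)]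
  simp

/-- A centered log-concave density is not too small at the origin. -/
theorem exists_pos_le_mul_pow (μ : Measure F) [μ.IsAddHaarMeasure] :
    ∃ c > 0, ∀ (g : F → ℝ) (L : ℝ), IsLogConcaveDensity μ g L →
      c ≤ g 0 * L ^ Module.finrank ℝ F := by
  set d := Module.finrank ℝ F with hd
  -- Any fixed integrable profile with controlled logarithm serves; `Z` normalizes it.
  set w : F → ℝ := fun u => (1 + ‖u‖) ^ (-((d : ℝ) + 1)) with hw
  have hwi : Integrable w μ := integrable_one_add_norm (by simp [hd])
  have hw0 : ∀ u, 0 < w u := fun u => Real.rpow_pos_of_pos (by positivity) _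
  set Z := ∫ u, w u ∂μ with hZ
  have hZ0 : 0 < Z := by
    refine (integral_pos_iff_support_of_nonneg (fun u => (hw0 u).le) hwi).2 ?_
    have : Function.support w = univ := by ext u; simp [(hw0 u).ne']
    rw [this]
    exact isOpen_univ.measure_pos μ ⟨0, trivial⟩
  refine ⟨Real.exp (-(((d : ℝ) + 1) * (1 + d) / 2) - Real.log Z), Real.exp_pos _, ?_⟩
  intro g L h
  have hL := h.pos
  obtain ⟨θ, hθ⟩ := h.exists_le_mul_exp
  have hg0 := h.zero_pos
  set A : ℝ := Real.log (Z * L ^ d) + Real.log (g 0) with hA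
  have hφi : Integrable (fun u => (Z * L ^ d)⁻¹ * w (L⁻¹ • u)) μ :=
    (hwi.comp_smul (inv_ne_zero hL.ne')).const_mul _
  have hφ1 : ∫ u, (Z * L ^ d)⁻¹ * w (L⁻¹ • u) ∂μ = 1 := by
    rw [integral_const_mul, Measure.integral_comp_smul_of_nonneg _ _ _ (hR := by positivity),
      ← hZ, ← hd, smul_eq_mul, inv_pow, inv_inv]
    field_simp
  -- Pointwise Gibbs inequality `g * log (φ / g) ≤ φ - g`, where `φ` is the rescaled profile. On the
  -- left `log φ` is bounded below by a quadratic, using `log (1 + x) ≤ x ≤ (1 + x²) / 2`, and `log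
  -- g` above by the linear majorant. After integration the right side vanishes, the linear term
  -- drops out by centering and the quadratic one equals a constant.
  have hpt : ∀ u, (-(((d : ℝ) + 1) / 2) - A) * g u - (((d : ℝ) + 1) / 2 * (L ^ 2)⁻¹) * (‖u‖ ^ 2 * g u)
      - inner ℝ θ u * g u ≤ (Z * L ^ d)⁻¹ * w (L⁻¹ • u) - g u := by
    intro u
    set φ := (Z * L ^ d)⁻¹ * w (L⁻¹ • u) with hφ
    have hφ0 : 0 < φ := mul_pos (by positivity) (hw0 _)
    rcases (h.nonneg u).eq_or_lt with hu | hu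
    · simp [← hu, hφ0.le]
    · have hx : 0 ≤ ‖u‖ / L := by positivity
      have hlog : Real.log φ = -((d : ℝ) + 1) * Real.log (1 + ‖u‖ / L) - Real.log (Z * L ^ d) := by
        rw [hφ, Real.log_mul (by positivity) (hw0 _).ne', hw, Real.log_inv]
        simp only [norm_smul, norm_inv, Real.norm_of_nonneg hL.le]
        rw [Real.log_rpow (by positivity), inv_mul_eq_div]
        ring
      have h1 : Real.log (1 + ‖u‖ / L) ≤ ‖u‖ / L := by
        have := Real.log_le_sub_one_of_pos (show 0 < 1 + ‖u‖ / L by positivity)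
        linarith
      have h2 : ‖u‖ / L ≤ (1 + (L ^ 2)⁻¹ * ‖u‖ ^ 2) / 2 := by
        have : (‖u‖ / L) ^ 2 = (L ^ 2)⁻¹ * ‖u‖ ^ 2 := by rw [div_pow]; ring
        nlinarith [sq_nonneg (‖u‖ / L - 1)]
      have h3 := Real.log_le_sub_one_of_pos (show 0 < φ / g u by positivity)
      rw [Real.log_div hφ0.ne' hu.ne'] at h3
      have h4 := hθ u hu
      have h5 : -(((d : ℝ) + 1) / 2) - A - (((d : ℝ) + 1) / 2 * (L ^ 2)⁻¹) * ‖u‖ ^ 2 - inner ℝ θ u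
          ≤ φ / g u - 1 := by
        have : ((d : ℝ) + 1) * Real.log (1 + ‖u‖ / L) ≤
            ((d : ℝ) + 1) * ((1 + (L ^ 2)⁻¹ * ‖u‖ ^ 2) / 2) := by
          gcongr; exact h1.trans h2
        linarith
      calc _ = (-(((d : ℝ) + 1) / 2) - A - (((d : ℝ) + 1) / 2 * (L ^ 2)⁻¹) * ‖u‖ ^ 2 - inner ℝ θ u) * g u := by
            ring
        _ ≤ (φ / g u - 1) * g u := by gcongr
        _ = _ := by field_simp
  have i1 : Integrable (fun u => inner ℝ θ u * g u) μ := h.integrable_mul (by fun_prop)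
  have i2 : Integrable (fun u => ‖u‖ ^ 2 * g u) μ := h.integrable_mul (by fun_prop)
  have i3 := h.integrable
  have i4 : Integrable (fun u => (-(((d : ℝ) + 1) / 2) - A) * g u -
      (((d : ℝ) + 1) / 2 * (L ^ 2)⁻¹) * (‖u‖ ^ 2 * g u)) μ := (i3.const_mul _).sub (i2.const_mul _)
  have hint := integral_mono (i4.sub i1) (hφi.sub i3) hpt
  simp only [Pi.sub_apply] at hint
  rw [integral_sub i4 i1,
    integral_sub (i3.const_mul _) (i2.const_mul _), integral_sub hφi i3, integral_const_mul,
    integral_const_mul, h.integral_eq_one, h.integral_inner, h.integral_norm_sq, hφ1] at hint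
  have e : ((d : ℝ) + 1) / 2 * (L ^ 2)⁻¹ * (d * L ^ 2) = ((d : ℝ) + 1) / 2 * d := by field_simp
  rw [← hd, e] at hint
  rw [hA, Real.log_mul hZ0.ne' (by positivity)] at hint
  rw [← Real.exp_log (show 0 < g 0 * L ^ d by positivity), Real.exp_le_exp,
    Real.log_mul hg0.ne' (by positivity)]
  linarith

/-- Beyond height `2 * τ` the point `u / 2` still lies in the half-space, so `g u * g 0 ≤ g (u / 2)
^ 2` yields `g u ≤ q * g (u / 2)`. The substitution `u ↦ u / 2` costs `2 ^ d` for the volume and `4`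
for the square. -/
theorem integral_max_inner_sq_le [μ.IsAddHaarMeasure] (h : IsLogConcaveDensity μ g L) {θ : F}
    (hθ : ‖θ‖ = 1) {τ q : ℝ} (hτ : 0 ≤ τ) (hq : 0 ≤ q) (H : ∀ u, τ ≤ inner ℝ θ u → g u ≤ q * g 0) :
    ∫ u, max (inner ℝ θ u) 0 ^ 2 * g u ∂μ ≤
      4 * τ ^ 2 + 2 ^ (Module.finrank ℝ F + 2) * q * L ^ 2 := by
  have hi : Integrable (fun u => inner ℝ θ u ^ 2 * g u) μ := h.integrable_mul (by fun_prop)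
  set ψ : F → ℝ := fun u => inner ℝ θ u ^ 2 * g u with hψ
  have hi2 : Integrable (fun u => ψ ((1 / 2 : ℝ) • u)) μ := hi.comp_smul (by norm_num)
  have hpt : ∀ u, max (inner ℝ θ u) 0 ^ 2 * g u ≤
      4 * τ ^ 2 * g u + 4 * q * ψ ((1 / 2 : ℝ) • u) := by
    intro u
    have hn := h.nonneg u
    have hn2 := h.nonneg ((1 / 2 : ℝ) • u)
    have hψ0 : 0 ≤ ψ ((1 / 2 : ℝ) • u) := by positivity
    rcases le_total (inner ℝ θ u) (2 * τ) with h1 | h1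
    · have : max (inner ℝ θ u) 0 ≤ 2 * τ := max_le h1 (by positivity)
      have h2 : max (inner ℝ θ u) 0 ^ 2 ≤ (2 * τ) ^ 2 := by gcongr
      have h3 := mul_le_mul_of_nonneg_right h2 hn
      have : 0 ≤ 4 * q * ψ ((1 / 2 : ℝ) • u) := by positivity
      nlinarith
    · have h2 : g u ≤ q * g ((1 / 2 : ℝ) • u) := by
        have e := h.rpow_mul_rpow_le u 0 (1 / 2) (1 / 2) (by norm_num) (by norm_num) (by norm_num)
        rw [smul_zero, add_zero, ← Real.sqrt_eq_rpow, ← Real.sqrt_eq_rpow] at e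
        have e2 : g u * g 0 ≤ g ((1 / 2 : ℝ) • u) * g ((1 / 2 : ℝ) • u) := by
          have := mul_le_mul e e (by positivity) hn2
          rwa [mul_mul_mul_comm, Real.mul_self_sqrt hn, Real.mul_self_sqrt h.zero_pos.le] at this
        have e3 := H ((1 / 2 : ℝ) • u) (by rw [inner_smul_right]; linarith)
        have e4 : g u * g 0 ≤ (q * g ((1 / 2 : ℝ) • u)) * g 0 := by
          calc _ ≤ _ := e2
            _ ≤ g ((1 / 2 : ℝ) • u) * (q * g 0) := by gcongr
            _ = _ := by ring
        exact le_of_mul_le_mul_right e4 h.zero_pos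
      have h0 : 0 ≤ inner ℝ θ u := le_trans (by positivity) h1
      rw [max_eq_left h0]
      have e5 : 4 * q * ψ ((1 / 2 : ℝ) • u) = inner ℝ θ u ^ 2 * (q * g ((1 / 2 : ℝ) • u)) := by
        simp only [hψ, inner_smul_right]; ring
      have : 0 ≤ 4 * τ ^ 2 * g u := by positivity
      have : inner ℝ θ u ^ 2 * g u ≤ inner ℝ θ u ^ 2 * (q * g ((1 / 2 : ℝ) • u)) := by gcongr
      linarith
  have := integral_mono (h.integrable_mul (by fun_prop)) ((h.integrable.const_mul _).add (hi2.const_mul _)) hpt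
  simp only [Pi.add_apply] at this
  rw [integral_add (h.integrable.const_mul _) (hi2.const_mul _), integral_const_mul,
    integral_const_mul, h.integral_eq_one,
    Measure.integral_comp_smul_of_nonneg _ _ _ (hR := by norm_num), h.integral_inner_sq θ hθ] at this
  refine this.trans (le_of_eq ?_)
  rw [smul_eq_mul, one_div, inv_pow, inv_inv, pow_add]
  ring

/-- A small first moment on the left forces `f s < q * f 0` at some `s` in `[-T, 0)`; since
superlevel sets are intervals containing `0`, the bound persists to the left of `s`, and the
half-space estimate applies with direction `-1`. -/
theorem integral_max_neg_sq_le {f : ℝ → ℝ} (h : IsLogConcaveDensity volume f L) {T q : ℝ}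
    (hT : 0 < T) (hq : 0 ≤ q) (hq1 : q ≤ 1)
    (H : ∫ t, max (-t) 0 * f t < T ^ 2 / 2 * (q * f 0)) :
    ∫ t, max (-t) 0 ^ 2 * f t ≤ 4 * T ^ 2 + 8 * q * L ^ 2 := by
  obtain ⟨s, hs, hsf⟩ : ∃ s ∈ Ico (-T) 0, f s < q * f 0 := by
    by_contra! hcon
    refine absurd H (not_lt.2 ?_)
    have hi : Integrable (fun t => max (-t) 0 * f t) := h.integrable_mul (by fun_prop)
    have h1 : ∫ t in Ico (-T) 0, (-t) * (q * f 0) ≤ ∫ t in Ico (-T) 0, max (-t) 0 * f t := by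
      refine setIntegral_mono_on ?_ hi.integrableOn measurableSet_Ico fun t ht => ?_
      · exact (((continuous_neg.mul continuous_const).integrableOn_Icc
          (a := -T) (b := 0)).mono_set Ico_subset_Icc_self)
      · rw [max_eq_left (by linarith [ht.2])]
        exact mul_le_mul_of_nonneg_left (hcon t ht) (by linarith [ht.2])
    have h2 : ∫ t in Ico (-T) 0, max (-t) 0 * f t ≤ ∫ t, max (-t) 0 * f t :=
      setIntegral_le_integral hi (ae_of_all _ fun t => mul_nonneg (le_max_right _ _) (h.nonneg t))
    refine le_trans (le_of_eq ?_) (h1.trans h2)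
    rw [integral_mul_const, integral_Ico_eq_integral_Ioc,
      ← intervalIntegral.integral_of_le (by linarith), intervalIntegral.integral_neg, integral_id]
    ring
  have key : ∀ t, T ≤ inner ℝ (-1 : ℝ) t → f t ≤ q * f 0 := by
    intro t ht
    have ht' : t ≤ -T := by
      have : inner ℝ (-1 : ℝ) t = -t := by simp
      linarith
    rcases (ht'.trans hs.1).eq_or_lt with h1 | h1
    · rw [h1]; exact hsf.le
    · have ht0 : t < 0 := by linarith
      have hs0 := hs.2
      have := h.min_le t 0 (a := s / t) (b := 1 - s / t) (div_pos_of_neg_of_neg hs0 ht0)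
        (by rw [sub_pos, div_lt_one_of_neg ht0]; exact h1) (by ring)
      rw [smul_zero, add_zero, smul_eq_mul, div_mul_cancel₀ _ ht0.ne] at this
      have h3 := this.trans_lt hsf
      have h4 : q * f 0 ≤ f 0 := mul_le_of_le_one_left h.zero_pos.le hq1
      rcases min_lt_iff.1 h3 with h5 | h5
      · exact h5.le
      · linarith
  have := h.integral_max_inner_sq_le (θ := -1) (by simp) hT.le hq key
  simp only [Module.finrank_self] at this
  convert this using 1
  · simp
  · norm_num

/-- A log-concave density with isotropic covariance, all of whose one-dimensional marginals have
log-concave densities, is comparable to its value at the origin on a ball of radius of order `L`. -/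
theorem exists_forall_mul_le (μ : Measure F) [μ.IsAddHaarMeasure] :
    ∃ c > 0, ∃ q > 0, ∀ (g : F → ℝ) (L : ℝ), IsLogConcaveDensity μ g L →
      (∀ θ : F, ‖θ‖ = 1 → ∃ f : ℝ → ℝ, IsLogConcaveDensity volume f L ∧
        ∀ φ : ℝ → ℝ, Continuous φ → ∫ t, φ t * f t = ∫ u, φ (inner ℝ θ u) * g u ∂μ) →
      ∀ u, ‖u‖ < c * L → q * g 0 ≤ g u := by
  obtain ⟨c₀, hc₀, hlow⟩ := exists_pos_le_mul_pow (volume : Measure ℝ)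
  -- With `T = L / 8` and `q = 1 / 32` in `integral_max_neg_sq_le`, the threshold `T² / 2 * (q * f
  -- 0)` is at least `c₀ * L / 4096`, and `κ` is half of `c₀ / 4096`.
  set κ : ℝ := c₀ / 8192 with hκ
  have hκ0 : 0 < κ := by positivity
  set ε : ℝ := min (κ ^ 2) (1 / 4) with hε
  have hε0 : 0 < ε := lt_min (by positivity) (by norm_num)
  set D : ℝ := 2 ^ (Module.finrank ℝ F + 2) with hD
  have hD0 : 0 < D := by positivity
  refine ⟨Real.sqrt (ε / 8), by positivity, ε / 2 / D, by positivity, ?_⟩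
  intro g L h hmarg u₀ hu₀
  have hL := h.pos
  by_contra! hcon
  set q := ε / 2 / D with hq
  have hq0 : 0 < q := by positivity
  -- Separating `u₀` from the closed convex superlevel set gives a half-space at distance `τ ≤ ‖u₀‖`
  -- from the origin on which `g < q * g 0`.
  obtain ⟨ℓ, s, hs, hsu⟩ := geometric_hahn_banach_closed_point (h.convex_le (q * g 0))
    (h.isClosed_le (q * g 0)) (x := u₀) (not_le.2 hcon)
  have hq1 : q ≤ 1 := by
    have h1 : ε ≤ 1 / 4 := min_le_right _ _
    have h2 : (1 : ℝ) ≤ D := one_le_pow₀ (by norm_num)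
    rw [hq, div_le_one hD0]
    linarith
  have hs0 : 0 < s := by
    have := hs 0 (mul_le_of_le_one_left h.zero_pos.le hq1)
    simpa using this
  set v := (InnerProductSpace.toDual ℝ F).symm ℓ with hv
  have hℓv : ∀ u, ℓ u = inner ℝ v u := fun u => by
    rw [hv, InnerProductSpace.toDual_symm_apply]
  have hv0 : 0 < ‖v‖ := by
    rw [norm_pos_iff]
    intro hv0
    have := hℓv u₀
    rw [hv0, inner_zero_left] at this
    linarith
  set θ := ‖v‖⁻¹ • v with hθ
  have hθ1 : ‖θ‖ = 1 := by rw [hθ, norm_smul, norm_inv, norm_norm, inv_mul_cancel₀ hv0.ne']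
  have hθi : ∀ u, inner ℝ θ u = ‖v‖⁻¹ * ℓ u := fun u => by
    rw [hθ, real_inner_smul_left, hℓv]
  set τ := ‖v‖⁻¹ * s with hτ
  have hτ0 : 0 < τ := by positivity
  have hτL : τ < Real.sqrt (ε / 8) * L := by
    refine lt_of_le_of_lt ?_ hu₀
    calc τ ≤ inner ℝ θ u₀ := by
            rw [hθi]; exact mul_le_mul_of_nonneg_left hsu.le (inv_nonneg.2 hv0.le)
      _ ≤ ‖θ‖ * ‖u₀‖ := real_inner_le_norm _ _
      _ = ‖u₀‖ := by rw [hθ1, one_mul]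
  have hplus := h.integral_max_inner_sq_le hθ1 hτ0.le hq0.le fun u hu => by
    by_contra! h1
    have h2 := hs u h1.le
    rw [hθi] at hu
    have := le_of_mul_le_mul_left hu (inv_pos.2 hv0)
    linarith
  have hplus2 : ∫ u, max (inner ℝ θ u) 0 ^ 2 * g u ∂μ ≤ ε * L ^ 2 := by
    refine hplus.trans ?_
    have h1 : τ ^ 2 ≤ ε / 8 * L ^ 2 := by
      calc τ ^ 2 ≤ (Real.sqrt (ε / 8) * L) ^ 2 := by gcongr
        _ = _ := by rw [mul_pow, Real.sq_sqrt (by positivity)]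
    have h2 : D * q = ε / 2 := by rw [hq]; field_simp
    rw [← hD, h2]
    linarith
  obtain ⟨f, hf, hfg⟩ := hmarg θ hθ1
  have t2 := hfg (fun t => max t 0 ^ 2) (by fun_prop)
  rw [← t2] at hplus2
  -- Centering balances the two one-sided first moments, which carries smallness from the positive
  -- side to the negative one.
  have hmean : ∫ t, max (-t) 0 * f t = ∫ t, max t 0 * f t := by
    have e := hf.integral_inner 1
    have e2 : ∀ t : ℝ, inner ℝ 1 t * f t = max t 0 * f t - max (-t) 0 * f t := by
      intro t
      rw [← sub_mul]
      congr 1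
      rcases le_total 0 t with ht | ht
      · rw [max_eq_left ht, max_eq_right (by linarith)]; simp
      · rw [max_eq_right ht, max_eq_left (by linarith)]; simp
    simp_rw [e2] at e
    rw [integral_sub (hf.integrable_mul (by fun_prop)) (hf.integrable_mul (by fun_prop))] at e
    linarith
  have hfirst : ∫ t, max (-t) 0 * f t ≤ κ * L := by
    rw [hmean]
    have i2 : Integrable (fun t => max t 0 ^ 2 * f t) := hf.integrable_mul (by fun_prop)
    -- Cauchy–Schwarz in the form `x ≤ κL / 2 + x² / (2κL)`.
    have hm := integral_mono (hf.integrable_mul (φ := fun t => max t 0) (by fun_prop))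
      ((hf.integrable.const_mul (κ * L / 2)).add (i2.const_mul ((2 * κ * L)⁻¹))) (fun t => by
        simp only [Pi.add_apply]
        rw [← mul_assoc, ← add_mul]
        refine mul_le_mul_of_nonneg_right ?_ (hf.nonneg t)
        have : (2 * κ * L)⁻¹ * max t 0 ^ 2 + κ * L / 2 - max t 0 =
          (2 * κ * L)⁻¹ * (max t 0 - κ * L) ^ 2 := by field_simp; ring
        have : 0 ≤ (2 * κ * L)⁻¹ * (max t 0 - κ * L) ^ 2 := by positivity
        linarith)
    simp only [Pi.add_apply] at hm
    rw [integral_add (hf.integrable.const_mul _) (i2.const_mul _), integral_const_mul,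
      integral_const_mul, hf.integral_eq_one] at hm
    have h1 : (2 * κ * L)⁻¹ * ∫ t, max t 0 ^ 2 * f t ≤ (2 * κ * L)⁻¹ * (κ ^ 2 * L ^ 2) := by
      gcongr
      exact hplus2.trans (mul_le_mul_of_nonneg_right (min_le_left _ _) (sq_nonneg L))
    have h2 : (2 * κ * L)⁻¹ * (κ ^ 2 * L ^ 2) = κ * L / 2 := by field_simp
    linarith
  have hf0 := hlow f L hf
  rw [Module.finrank_self, pow_one] at hf0
  have hminus := hf.integral_max_neg_sq_le (T := L / 8) (q := 1 / 32) (by positivity) (by norm_num)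
    (by norm_num) (by
      refine hfirst.trans_lt ?_
      have : κ * L < L / 4096 * c₀ := by rw [hκ]; nlinarith
      nlinarith)
  have hsum : L ^ 2 = (∫ t, max t 0 ^ 2 * f t) + ∫ t, max (-t) 0 ^ 2 * f t := by
    rw [← integral_add (hf.integrable_mul (by fun_prop)) (hf.integrable_mul (by fun_prop)),
      ← hf.integral_inner_sq 1 (by simp)]
    refine integral_congr_ae (ae_of_all _ fun t => ?_)
    rcases le_total 0 t with ht | ht
    · simp [max_eq_left ht, max_eq_right (show -t ≤ 0 by linarith)]
    · simp [max_eq_right ht, max_eq_left (show 0 ≤ -t by linarith)]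
  -- The two halves of the variance are at most `L² / 4` and `4 (L / 8)² + 8 / 32 * L² = 5 L² / 16`,
  -- with sum below `L²`.
  have hε4 : ε ≤ 1 / 4 := min_le_right _ _
  have : 0 < L ^ 2 := by positivity
  nlinarith

theorem exists_mul_pow_le (μ : Measure F) [μ.IsAddHaarMeasure] :
    ∃ C > 0, ∀ (g : F → ℝ) (L : ℝ), IsLogConcaveDensity μ g L →
      (∀ θ : F, ‖θ‖ = 1 → ∃ f : ℝ → ℝ, IsLogConcaveDensity volume f L ∧
        ∀ φ : ℝ → ℝ, Continuous φ → ∫ t, φ t * f t = ∫ u, φ (inner ℝ θ u) * g u ∂μ) →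
      g 0 * L ^ Module.finrank ℝ F ≤ C := by
  obtain ⟨c, hc, q, hq, H⟩ := exists_forall_mul_le μ
  set V := μ.real (ball (0 : F) c) with hV
  have hV0 : 0 < V := ENNReal.toReal_pos (measure_ball_pos μ _ hc).ne' measure_ball_lt_top.ne
  refine ⟨(q * V)⁻¹, by positivity, fun g L h hm => ?_⟩
  have hL := h.pos
  have hball : μ.real (ball (0 : F) (c * L)) = L ^ Module.finrank ℝ F * V := by
    have : ball (0 : F) (c * L) = L • ball (0 : F) c := by
      rw [_root_.smul_ball hL.ne', smul_zero, Real.norm_of_nonneg hL.le, mul_comm]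
    rw [this, measureReal_def, Measure.addHaar_smul, ENNReal.toReal_mul, ENNReal.toReal_ofReal (abs_nonneg _),
      abs_of_pos (by positivity), hV, measureReal_def]
  have h1 : ∫ u in ball (0 : F) (c * L), q * g 0 ∂μ ≤ ∫ u in ball (0 : F) (c * L), g u ∂μ := by
    refine setIntegral_mono_on ?_ h.integrable.integrableOn measurableSet_ball fun u hu => ?_
    · exact integrableOn_const measure_ball_lt_top.ne
    · exact H g L h hm u (by simpa using hu)
  have h2 := h1.trans (setIntegral_le_integral h.integrable (ae_of_all _ h.nonneg))
  rw [setIntegral_const, hball, h.integral_eq_one, smul_eq_mul] at h2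
  rw [← one_div, le_div_iff₀ (by positivity)]
  linarith

end IsLogConcaveDensity

/-! ### Upper semicontinuity of integrals and measures depending on a parameter. -/

/-- Reverse Fatou along a sequence violating the claim; first countability supplies the sequence. -/
theorem upperSemicontinuousAt_lintegral {X α : Type*} [TopologicalSpace X] [FirstCountableTopology X]
    [MeasurableSpace α] {ν : Measure α} {f : X → α → ℝ≥0∞} {G : α → ℝ≥0∞} {x₀ : X}
    (hm : ∀ x, Measurable (f x)) (hG : ∀ x a, f x a ≤ G a) (hGi : ∫⁻ a, G a ∂ν ≠ ∞)
    (h : ∀ a, UpperSemicontinuousAt (fun x => f x a) x₀) :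
    UpperSemicontinuousAt (fun x => ∫⁻ a, f x a ∂ν) x₀ := by
  intro y hy
  by_contra hcon
  obtain ⟨xs, hxs, hxy⟩ := Filter.exists_seq_forall_of_frequently (Filter.not_eventually.1 hcon)
  have h1 : y ≤ Filter.limsup (fun n => ∫⁻ a, f (xs n) a ∂ν) Filter.atTop :=
    Filter.le_limsup_of_le (by isBoundedDefault) fun b hb => by
      obtain ⟨n, hn⟩ := (Filter.Eventually.exists hb)
      exact (not_lt.1 (hxy n)).trans hn
  have h2 := limsup_lintegral_le G (fun n => hm (xs n)) (fun n => ae_of_all ν (hG (xs n))) hGi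
  have h3 : ∫⁻ a, Filter.limsup (fun n => f (xs n) a) Filter.atTop ∂ν ≤ ∫⁻ a, f x₀ a ∂ν := by
    refine lintegral_mono fun a => le_of_forall_gt_imp_ge_of_dense fun z hz => ?_
    exact Filter.limsup_le_of_le (by isBoundedDefault)
      ((hxs.eventually (h a z hz)).mono fun n hn => le_of_lt hn)
  exact absurd (h1.trans (h2.trans h3)) (not_le.2 hy)

theorem upperSemicontinuousAt_measure {X α : Type*} [TopologicalSpace X] [FirstCountableTopology X]
    [MeasurableSpace α] {ν : Measure α} {A : X → Set α} {B : Set α} {x₀ : X}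
    (hm : ∀ x, MeasurableSet (A x)) (hBm : MeasurableSet B) (hB : ∀ x, A x ⊆ B) (hBi : ν B ≠ ∞)
    (h : ∀ a ∉ A x₀, ∀ᶠ x in 𝓝 x₀, a ∉ A x) :
    UpperSemicontinuousAt (fun x => ν (A x)) x₀ := by
  have key := upperSemicontinuousAt_lintegral (ν := ν) (x₀ := x₀) (f := fun x => (A x).indicator 1)
    (G := B.indicator 1) (fun x => measurable_one.indicator (hm x))
    (fun x a => indicator_le_indicator_of_subset (hB x) (fun _ => zero_le) a)
    (by simpa [lintegral_indicator_one hBm] using hBi) ?_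
  · simpa [lintegral_indicator_one, hm] using key
  · intro a y hy
    by_cases ha : a ∈ A x₀
    · simp only [indicator_of_mem ha, Pi.one_apply] at hy
      exact Filter.Eventually.of_forall fun x => (indicator_le_self _ _ a).trans_lt hy
    · filter_upwards [h a ha] with x hx
      simp only [indicator_of_notMem ha] at hy
      simpa [indicator_of_notMem hx] using hy

/-! ### Moving hyperplanes by half-turns. -/

section Perp

variable {E E' : Type*} [NormedAddCommGroup E] [InnerProductSpace ℝ E]
  [NormedAddCommGroup E'] [InnerProductSpace ℝ E']

theorem mem_perp {ξ x : E} : x ∈ perp ξ ↔ inner ℝ ξ x = 0 :=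
  Submodule.mem_orthogonal_singleton_iff_inner_right

/-- A linear isometry taking `ξ` to `η` restricts to an isometry from `ξ^⊥` to `η^⊥`. -/
noncomputable def perpCongr (V : E ≃ₗᵢ[ℝ] E') {ξ : E} {η : E'} (h : V ξ = η) :
    perp ξ ≃ₗᵢ[ℝ] perp η where
  toFun x := ⟨V x, by rw [mem_perp, ← h, V.inner_map_map]; exact mem_perp.1 x.2⟩
  invFun y := ⟨V.symm y, by
    rw [mem_perp, ← V.inner_map_map, h, V.apply_symm_apply]; exact mem_perp.1 y.2⟩
  map_add' x y := by ext; simp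
  map_smul' c x := by ext; simp
  left_inv x := by ext; simp
  right_inv x := by ext; simp
  norm_map' x := V.norm_map x

/-- The half-turn about the line through `ξ + η`, exchanging the unit vectors `ξ` and `η`. -/
noncomputable def halfTurn (ξ η : E) : E ≃ₗᵢ[ℝ] E := (Submodule.span ℝ {ξ + η}).reflection

theorem halfTurn_apply_left {ξ η : E} (h : ‖ξ‖ = ‖η‖) : halfTurn ξ η ξ = η := by
  -- The reflection in the hyperplane orthogonal to `ξ - (-η)` sends `ξ` to `-η`; the half-turn is
  -- its negative. The degenerate case `η = -ξ` is included.
  have h1 := Submodule.reflection_sub (F := E) (v := ξ) (w := -η) (by simpa using h)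
  rw [sub_neg_eq_add, Submodule.reflection_orthogonal_apply] at h1
  rw [halfTurn]
  simpa using h1

theorem continuousAt_halfTurn {ξ : E} (hξ : ξ ≠ 0) (x : E) :
    ContinuousAt (fun η => halfTurn ξ η x) ξ := by
  have e : ∀ η, halfTurn ξ η x =
      (2 : ℕ) • (inner ℝ (ξ + η) x / ‖ξ + η‖ ^ 2) • (ξ + η) - x := fun η => by
    rw [halfTurn, Submodule.reflection_singleton_apply]; simp
  simp_rw [e]
  have h0 : ‖ξ + ξ‖ ^ 2 ≠ 0 := by
    rw [← two_smul ℝ ξ]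
    simp [hξ]
  have : ContinuousAt (fun η => inner ℝ (ξ + η) x / ‖ξ + η‖ ^ 2) ξ :=
    ContinuousAt.div (by fun_prop) (by fun_prop) h0
  fun_prop

end Perp

/-! ### Semicontinuity of section volumes and of their averages. -/

section Sections

variable {E E' : Type*} [NormedAddCommGroup E] [InnerProductSpace ℝ E] [FiniteDimensional ℝ E]
  [MeasurableSpace E] [BorelSpace E]
  [NormedAddCommGroup E'] [InnerProductSpace ℝ E'] [FiniteDimensional ℝ E']
  [MeasurableSpace E'] [BorelSpace E']

omit [MeasurableSpace E] [BorelSpace E] in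
theorem isCompact_sect {K : Set E} (hK : IsCompact K) (ξ : E) : IsCompact (sect K ξ) :=
  (perp ξ).closed_of_finiteDimensional.isClosedEmbedding_subtypeVal.isCompact_preimage hK

/-- The hyperplanes `η^⊥` are different spaces; this expresses every section volume as the measure
of a set in the single space `ξ^⊥`, where semicontinuity in `η` makes sense. -/
theorem volume_sect_halfTurn (A : Set E) {ξ η : E} (h : ‖ξ‖ = ‖η‖) :
    volume (sect A η) = volume {y : perp ξ | halfTurn ξ η y ∈ A} := by
  rw [← (perpCongr (halfTurn ξ η) (halfTurn_apply_left h)).measurePreserving.measure_preimage_equiv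
    (f := (perpCongr (halfTurn ξ η) (halfTurn_apply_left h)).toMeasurableEquiv)]
  rfl

theorem upperSemicontinuous_volume_sect {A : Set E} (hA : IsCompact A) :
    UpperSemicontinuous fun η : sphere (0 : E) 1 => volume (sect A (η : E)) := by
  intro ξ
  have hn : ∀ η : sphere (0 : E) 1, ‖(ξ : E)‖ = ‖(η : E)‖ := fun η => by
    rw [norm_eq_of_mem_sphere, norm_eq_of_mem_sphere]
  simp_rw [fun η : sphere (0 : E) 1 => volume_sect_halfTurn A (hn η)]
  obtain ⟨R, hR⟩ := hA.isBounded.subset_closedBall 0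
  refine upperSemicontinuousAt_measure (B := closedBall 0 R) (fun η => ?_) measurableSet_closedBall
    (fun η y hy => ?_) measure_closedBall_lt_top.ne fun y hy => ?_
  · exact (hA.isClosed.preimage
      ((halfTurn (ξ : E) η).continuous.comp continuous_subtype_val)).measurableSet
  · simpa using hR hy
  · have hc : ContinuousAt (fun η : sphere (0 : E) 1 => halfTurn (ξ : E) η y) ξ :=
      (continuousAt_halfTurn (ne_zero_of_mem_unit_sphere ξ) (y : E)).comp
        continuous_subtype_val.continuousAt
    exact hc.eventually (hA.isClosed.isOpen_compl.mem_nhds hy)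

theorem measurable_volume_sect {A : Set E} (hA : IsCompact A) :
    Measurable fun η : sphere (0 : E) 1 => volume (sect A (η : E)) :=
  (upperSemicontinuous_volume_sect hA).measurable

instance isProbabilityMeasure_sphereProb [Nontrivial E] : IsProbabilityMeasure (sphereProb E) := by
  constructor
  rw [sphereProb, Measure.smul_apply, smul_eq_mul]
  exact ENNReal.inv_mul_cancel 
    (by rw [Ne, Measure.measure_univ_eq_zero]; exact Measure.toSphere_ne_zero _) (measure_ne_top _ _)

theorem avgSection_eq_toReal_lintegral {A : Set E} (hA : IsCompact A) :
    avgSection A = (∫⁻ ξ : sphere (0 : E) 1, volume (sect A (ξ : E)) ∂(sphereProb E)).toReal :=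
  integral_toReal (measurable_volume_sect hA).aemeasurable
    (ae_of_all _ fun ξ => (isCompact_sect hA (ξ : E)).measure_lt_top)

/-- Supplies the constant dominating function for reverse Fatou: the section volume of the ball,
being upper semicontinuous, attains its maximum on the sphere. -/
theorem exists_forall_volume_sect_le [Nontrivial E] (R : ℝ) : ∃ M : ℝ≥0∞, M ≠ ∞ ∧
    ∀ A : Set E, A ⊆ closedBall 0 R → ∀ ξ : sphere (0 : E) 1, volume (sect A (ξ : E)) ≤ M := by
  have : Nonempty (sphere (0 : E) 1) := (NormedSpace.sphere_nonempty.2 zero_le_one).to_subtype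
  obtain ⟨ξ, -, hξ⟩ := ((upperSemicontinuous_volume_sect
    (isCompact_closedBall (0 : E) R)).upperSemicontinuousOn univ).exists_isMaxOn
    univ_nonempty isCompact_univ
  refine ⟨volume (sect (closedBall 0 R) (ξ : E)),
    (isCompact_sect (isCompact_closedBall (0 : E) R) (ξ : E)).measure_lt_top.ne, fun A hA η => ?_⟩
  have h : volume (sect A (η : E)) ≤ volume (sect (closedBall 0 R) (η : E)) :=
    measure_mono fun y hy => hA hy
  exact h.trans (hξ (mem_univ η))

theorem lintegral_volume_sect_lt_top [Nontrivial E] {A : Set E} (hA : IsCompact A) :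
    ∫⁻ ξ : sphere (0 : E) 1, volume (sect A (ξ : E)) ∂(sphereProb E) < ∞ := by
  obtain ⟨R, hR⟩ := hA.isBounded.subset_closedBall 0
  obtain ⟨M, hM, h⟩ := exists_forall_volume_sect_le (E := E) R
  refine (lintegral_mono (h A hR)).trans_lt ?_
  simpa using hM.lt_top

theorem upperSemicontinuousAt_lintegral_volume_sect [Nontrivial E] {X : Type*} [TopologicalSpace X]
    [FirstCountableTopology X] {A : X → Set E} {R : ℝ} {x₀ : X} (hA : ∀ x, IsCompact (A x))
    (hR : ∀ x, A x ⊆ closedBall 0 R) (h : ∀ y ∉ A x₀, ∀ᶠ x in 𝓝 x₀, y ∉ A x) :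
    UpperSemicontinuousAt
      (fun x => ∫⁻ ξ : sphere (0 : E) 1, volume (sect (A x) (ξ : E)) ∂(sphereProb E)) x₀ := by
  obtain ⟨M, hM, hle⟩ := exists_forall_volume_sect_le (E := E) R
  refine upperSemicontinuousAt_lintegral (G := fun _ => M) (fun x => measurable_volume_sect (hA x))
    (fun x => hle (A x) (hR x)) (by simpa using hM) fun η => ?_
  refine upperSemicontinuousAt_measure (B := closedBall 0 R)
    (fun x => (isCompact_sect (hA x) (η : E)).measurableSet) measurableSet_closedBall
    (fun x y hy => by simpa using hR x hy) measure_closedBall_lt_top.ne fun y hy => h y hy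

/-- A linear isometry induces a measurable equivalence of unit spheres. -/
noncomputable def sphereCongr (V : E ≃ₗᵢ[ℝ] E') : sphere (0 : E) 1 ≃ᵐ sphere (0 : E') 1 where
  toFun x := ⟨V x, mem_sphere_zero_iff_norm.2 ((V.norm_map x).trans (norm_eq_of_mem_sphere x))⟩
  invFun y := ⟨V.symm y,
    mem_sphere_zero_iff_norm.2 ((V.symm.norm_map y).trans (norm_eq_of_mem_sphere y))⟩
  left_inv x := by ext; simp
  right_inv y := by ext; simp
  measurable_toFun := (V.continuous.measurable.comp measurable_subtype_coe).subtype_mk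
  measurable_invFun := (V.symm.continuous.measurable.comp measurable_subtype_coe).subtype_mk

theorem measurePreserving_sphereCongr (V : E ≃ₗᵢ[ℝ] E') :
    MeasurePreserving (sphereCongr V) (sphereProb E) (sphereProb E') := by
  have key : ∀ s : Set (sphere (0 : E') 1), MeasurableSet s →
      (volume : Measure E).toSphere (sphereCongr V ⁻¹' s) = (volume : Measure E').toSphere s := by
    intro s hs
    -- The spherical measure of `s` is the dimension times the volume of the cone over `s`, and
    -- isometries preserve both.
    rw [Measure.toSphere_apply' _ ((sphereCongr V).measurable hs), Measure.toSphere_apply' _ hs,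
      V.toLinearEquiv.finrank_eq,
      ← V.measurePreserving.measure_preimage_equiv (f := V.toMeasurableEquiv)]
    congr 2
    ext x
    constructor
    · rintro ⟨r, hr, _, ⟨y, hy, rfl⟩, rfl⟩
      exact ⟨r, hr, V y, ⟨sphereCongr V y, hy, rfl⟩, by simp⟩
    · rintro ⟨r, hr, _, ⟨y, hy, rfl⟩, hx⟩
      refine ⟨r, hr, V.symm y, ⟨(sphereCongr V).symm y, by simpa using hy, rfl⟩, ?_⟩
      apply V.injective
      simpa using hx
  refine ⟨(sphereCongr V).measurable, Measure.ext fun s hs => ?_⟩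
  rw [Measure.map_apply (sphereCongr V).measurable hs, sphereProb, sphereProb, Measure.smul_apply,
    Measure.smul_apply, key s hs, ← key univ .univ, preimage_univ]

theorem lintegral_volume_sect_preimage (V : E ≃ₗᵢ[ℝ] E') (A : Set E') :
    ∫⁻ ξ : sphere (0 : E) 1, volume (sect (V ⁻¹' A) (ξ : E)) ∂(sphereProb E) =
      ∫⁻ η : sphere (0 : E') 1, volume (sect A (η : E')) ∂(sphereProb E') := by
  rw [← (measurePreserving_sphereCongr V).lintegral_comp_emb (sphereCongr V).measurableEmbedding]
  refine lintegral_congr fun ξ => ?_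
  rw [← (perpCongr V (ξ := (ξ : E)) (η := (sphereCongr V ξ : E')) rfl).measurePreserving.measure_preimage_equiv
    (f := (perpCongr V (ξ := (ξ : E)) (η := (sphereCongr V ξ : E')) rfl).toMeasurableEquiv)]
  rfl

theorem upperSemicontinuous_lintegral_volume_sect_sect {K : Set E} (hK : IsCompact K)
    (hE : ∀ ξ : sphere (0 : E) 1, Nontrivial (perp (ξ : E))) :
    UpperSemicontinuous fun ξ : sphere (0 : E) 1 =>
      ∫⁻ η : sphere (0 : perp (ξ : E)) 1, volume (sect (sect K (ξ : E)) (η : perp (ξ : E)))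
        ∂(sphereProb (perp (ξ : E))) := by
  intro ξ
  have := hE ξ
  have hn : ∀ η : sphere (0 : E) 1, ‖(ξ : E)‖ = ‖(η : E)‖ := fun η => by
    rw [norm_eq_of_mem_sphere, norm_eq_of_mem_sphere]
  simp_rw [fun η : sphere (0 : E) 1 => (lintegral_volume_sect_preimage
    (perpCongr (halfTurn (ξ : E) η) (halfTurn_apply_left (hn η))) (sect K (η : E))).symm]
  obtain ⟨R, hR⟩ := hK.isBounded.subset_closedBall 0
  refine upperSemicontinuousAt_lintegral_volume_sect (R := R) (fun η => ?_) (fun η y hy => ?_)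
    fun y hy => ?_
  · exact (perpCongr (halfTurn (ξ : E) η) (halfTurn_apply_left (hn η))).toHomeomorph.isCompact_preimage.2
      (isCompact_sect hK (η : E))
  · have : halfTurn (ξ : E) (η : E) (y : E) ∈ K := hy
    simpa using hR this
  · have hc : ContinuousAt (fun η : sphere (0 : E) 1 => halfTurn (ξ : E) η y) ξ :=
      (continuousAt_halfTurn (ne_zero_of_mem_unit_sphere ξ) (y : E)).comp
        continuous_subtype_val.continuousAt
    exact hc.eventually (hK.isClosed.isOpen_compl.mem_nhds hy)

theorem isGreatest_maxAvgSection [Nontrivial E] {K : Set E} (hK : IsCompact K)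
    (hE : ∀ ξ : sphere (0 : E) 1, Nontrivial (perp (ξ : E))) :
    IsGreatest (range fun ξ : sphere (0 : E) 1 => avgSection (sect K (ξ : E))) (maxAvgSection K) := by
  have : Nonempty (sphere (0 : E) 1) := (NormedSpace.sphere_nonempty.2 zero_le_one).to_subtype
  obtain ⟨ξ, -, hξ⟩ := ((upperSemicontinuous_lintegral_volume_sect_sect hK
    hE).upperSemicontinuousOn univ).exists_isMaxOn univ_nonempty isCompact_univ
  have h : IsGreatest (range fun ξ : sphere (0 : E) 1 => avgSection (sect K (ξ : E)))
      (avgSection (sect K (ξ : E))) := by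
    refine ⟨⟨ξ, rfl⟩, ?_⟩
    rintro _ ⟨η, rfl⟩
    have := hE ξ
    simp only [avgSection_eq_toReal_lintegral (isCompact_sect hK _)]
    exact ENNReal.toReal_mono (lintegral_volume_sect_lt_top (isCompact_sect hK _)).ne
      (hξ (mem_univ η))
  rwa [show maxAvgSection K = avgSection (sect K (ξ : E)) from h.csSup_eq]

theorem le_avgSection_and_avgSection_le [Nontrivial E] {A : Set E} (hA : IsCompact A) {p r : ℝ}
    (h : ∀ ξ : E, ‖ξ‖ = 1 → p ≤ vol (sect A ξ) ∧ vol (sect A ξ) ≤ r) :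
    p ≤ avgSection A ∧ avgSection A ≤ r := by
  have hi : Integrable (fun ξ : sphere (0 : E) 1 => vol (sect A (ξ : E))) (sphereProb E) :=
    integrable_toReal_of_lintegral_ne_top (measurable_volume_sect hA).aemeasurable
      (lintegral_volume_sect_lt_top hA).ne
  constructor
  · have := integral_mono (integrable_const p) hi fun ξ => (h ξ (norm_eq_of_mem_sphere ξ)).1
    rw [avgSection]
    simpa using this
  · have := integral_mono hi (integrable_const r) fun ξ => (h ξ (norm_eq_of_mem_sphere ξ)).2
    rw [avgSection]
    simpa using this

end Sections

/-- Otherwise a linear functional would be negative on the whole interior, and its integral over `K`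
could not vanish as the barycenter condition demands. -/
theorem IsIsotropicWith.zero_mem_interior {E : Type*} [NormedAddCommGroup E] [InnerProductSpace ℝ E]
    [FiniteDimensional ℝ E] [MeasurableSpace E] [BorelSpace E] {K : Set E} {L : ℝ}
    (h : IsIsotropicWith K L) : (0 : E) ∈ interior K := by
  by_contra h0
  obtain ⟨f, hf⟩ := geometric_hahn_banach_open_point h.convex.interior isOpen_interior h0
  rw [map_zero] at hf
  have hint : ∫ x in K, x = 0 := by
    have := h.barycenter_eq_zero
    rwa [h.vol_eq_one, inv_one, one_smul] at this
  have hii : IntegrableOn (fun x : E => x) K := continuous_id.continuousOn.integrableOn_compact h.isCompact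
  have h1 : ∫ x in K, (-f) x = 0 := by
    rw [ContinuousLinearMap.integral_comp_comm _ hii, hint, map_zero]
  have hK : K ⊆ closure (interior K) := by
    rw [h.convex.closure_interior_eq_closure_of_nonempty_interior h.interior_nonempty]
    exact subset_closure
  have hle : ∀ x ∈ K, 0 ≤ (-f) x := by
    intro x hx
    have : closure (interior K) ⊆ {x | 0 ≤ (-f) x} :=
      closure_minimal (fun y hy => by simpa using (hf y hy).le)
        (isClosed_le continuous_const (-f).continuous)
    exact this (hK hx)
  have h2 : 0 < ∫ x in K, (-f) x := by
    rw [setIntegral_pos_iff_support_of_nonneg_ae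
      ((ae_restrict_iff' h.isCompact.measurableSet).2 (ae_of_all _ hle))
      ((-f).continuous.continuousOn.integrableOn_compact h.isCompact)]
    refine (isOpen_interior.measure_pos volume h.interior_nonempty).trans_le
      (measure_mono fun x hx => ⟨?_, interior_subset hx⟩)
    have := hf x hx
    simp [this.ne]
  exact h2.ne' h1

/-! ### Orthogonal splittings and marginals of isotropic bodies. -/

section Splitting

variable {F G E : Type*} [NormedAddCommGroup F] [InnerProductSpace ℝ F] [MeasurableSpace F]
  [NormedAddCommGroup G] [InnerProductSpace ℝ G] [FiniteDimensional ℝ G]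
  [MeasurableSpace G] [BorelSpace G]
  [NormedAddCommGroup E] [InnerProductSpace ℝ E] [FiniteDimensional ℝ E]
  [MeasurableSpace E] [BorelSpace E]

/-- `Φ` identifies `E` with the orthogonal sum of `F` and `G`, as a Euclidean space with volume. -/
structure IsOrthogonalSplitting (μ : Measure F) (Φ : F × G →L[ℝ] E) : Prop where
  measurePreserving : MeasurePreserving Φ (μ.prod volume) volume
  inner_eq : ∀ p q, inner ℝ (Φ p) (Φ q) = inner ℝ p.1 q.1 + inner ℝ p.2 q.2

/-- The volume of the fibre of `K` over `u`. -/
noncomputable def fibreVolume (Φ : F × G →L[ℝ] E) (K : Set E) (u : F) : ℝ :=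
  vol {y : G | Φ (u, y) ∈ K}

namespace IsOrthogonalSplitting

variable {μ : Measure F} {Φ : F × G →L[ℝ] E} {K : Set E} {L : ℝ}

theorem norm_sq (hΦ : IsOrthogonalSplitting μ Φ) (u : F) (y : G) :
    ‖Φ (u, y)‖ ^ 2 = ‖u‖ ^ 2 + ‖y‖ ^ 2 := by
  rw [← real_inner_self_eq_norm_sq, hΦ.inner_eq, real_inner_self_eq_norm_sq,
    real_inner_self_eq_norm_sq]

theorem norm_fst_le (hΦ : IsOrthogonalSplitting μ Φ) (u : F) (y : G) : ‖u‖ ≤ ‖Φ (u, y)‖ :=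
  le_of_sq_le_sq (by rw [hΦ.norm_sq]; nlinarith [sq_nonneg ‖y‖]) (norm_nonneg _)

theorem norm_snd_le (hΦ : IsOrthogonalSplitting μ Φ) (u : F) (y : G) : ‖y‖ ≤ ‖Φ (u, y)‖ :=
  le_of_sq_le_sq (by rw [hΦ.norm_sq]; nlinarith [sq_nonneg ‖u‖]) (norm_nonneg _)

omit [MeasurableSpace F] [FiniteDimensional ℝ G] [FiniteDimensional ℝ E] [MeasurableSpace E] [BorelSpace E] in
theorem measurableSet_fibre (hK : IsCompact K) (u : F) : MeasurableSet {y : G | Φ (u, y) ∈ K} :=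
  (hK.isClosed.preimage (by fun_prop : Continuous fun y : G => Φ (u, y))).measurableSet

theorem fibre_subset (hΦ : IsOrthogonalSplitting μ Φ) {R : ℝ} (hR : K ⊆ closedBall 0 R) (u : F) :
    {y : G | Φ (u, y) ∈ K} ⊆ closedBall 0 R := fun y hy => by
  simpa using (hΦ.norm_snd_le u y).trans (by simpa using hR hy)

theorem volume_fibre_lt_top (hΦ : IsOrthogonalSplitting μ Φ) (hK : IsCompact K) (u : F) :
    volume {y : G | Φ (u, y) ∈ K} < ∞ := by
  obtain ⟨R, hR⟩ := hK.isBounded.subset_closedBall 0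
  exact (measure_mono (hΦ.fibre_subset hR u)).trans_lt measure_closedBall_lt_top

omit [MeasurableSpace F] [FiniteDimensional ℝ E] [MeasurableSpace E] [BorelSpace E] in
theorem integral_indicator_fibre (hK : IsCompact K) {ψ : E → ℝ} {φ : F → ℝ}
    (hψφ : ∀ u y, ψ (Φ (u, y)) = φ u) (u : F) :
    ∫ y : G, K.indicator ψ (Φ (u, y)) = φ u * fibreVolume Φ K u := by
  have e : ∀ y : G, K.indicator ψ (Φ (u, y)) =
      {y : G | Φ (u, y) ∈ K}.indicator (fun _ => φ u) y := fun y => by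
    by_cases hy : Φ (u, y) ∈ K
    · rw [indicator_of_mem hy, indicator_of_mem (show y ∈ {y : G | Φ (u, y) ∈ K} from hy), hψφ]
    · rw [indicator_of_notMem hy, indicator_of_notMem (show y ∉ {y : G | Φ (u, y) ∈ K} from hy)]
  simp_rw [e]
  rw [integral_indicator (measurableSet_fibre hK u), setIntegral_const, smul_eq_mul, mul_comm]
  rfl

theorem integrable_indicator_comp (hΦ : IsOrthogonalSplitting μ Φ) (hK : IsCompact K) {ψ : E → ℝ}
    (hψ : Continuous ψ) :
    Integrable (fun p : F × G => K.indicator ψ (Φ p)) (μ.prod volume) :=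
  hΦ.measurePreserving.integrable_comp_of_integrable
    ((integrable_indicator_iff hK.measurableSet).2
      (hψ.continuousOn.integrableOn_compact hK))

theorem integrable_fibreVolume (hΦ : IsOrthogonalSplitting μ Φ) (hK : IsCompact K) :
    Integrable (fibreVolume Φ K) μ := by
  have := (hΦ.integrable_indicator_comp hK (ψ := fun _ => 1) continuous_const).integral_prod_left
  simp_rw [integral_indicator_fibre hK (ψ := fun _ => 1) (φ := fun _ : F => (1 : ℝ))
    (fun _ _ => rfl), one_mul] at this
  exact this

variable [SFinite μ]

/-- Fubini; this is how mass, barycenter and covariance of `K` pass to the marginal. -/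
theorem integral_mul_fibreVolume (hΦ : IsOrthogonalSplitting μ Φ) (hK : IsCompact K) {ψ : E → ℝ}
    {φ : F → ℝ} (hψ : Continuous ψ) (hψφ : ∀ u y, ψ (Φ (u, y)) = φ u) :
    ∫ u, φ u * fibreVolume Φ K u ∂μ = ∫ x in K, ψ x := by
  have hi : Integrable (K.indicator ψ) :=
    (integrable_indicator_iff hK.measurableSet).2 (hψ.continuousOn.integrableOn_compact hK)
  rw [← integral_indicator hK.measurableSet, ← hΦ.measurePreserving.map_eq,
    integral_map hΦ.measurePreserving.aemeasurable
      (by rw [hΦ.measurePreserving.map_eq]; exact hi.aestronglyMeasurable),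
    integral_prod _ (hΦ.integrable_indicator_comp hK hψ)]
  simp_rw [integral_indicator_fibre hK hψφ]

/-- The marginals of an isotropic convex body are isotropic log-concave densities. -/
theorem isLogConcaveDensity (hΦ : IsOrthogonalSplitting μ Φ) (h : IsIsotropicWith K L) :
    IsLogConcaveDensity μ (fibreVolume Φ K) L where
  pos := h.pos
  nonneg u := ENNReal.toReal_nonneg
  isClosed_le r := by
    have husc : UpperSemicontinuous fun u : F => volume {y : G | Φ (u, y) ∈ K} := by
      intro u
      obtain ⟨R, hR⟩ := h.isCompact.isBounded.subset_closedBall 0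
      refine upperSemicontinuousAt_measure (fun v => measurableSet_fibre h.isCompact v)
        measurableSet_closedBall (fun v => hΦ.fibre_subset hR v) measure_closedBall_lt_top.ne
        fun y hy => ?_
      have hc : ContinuousAt (fun v : F => Φ (v, y)) u := by fun_prop
      exact hc.eventually (h.isCompact.isClosed.isOpen_compl.mem_nhds hy)
    convert upperSemicontinuous_iff_isClosed_preimage.1 husc (ENNReal.ofReal r) using 1
    ext u
    exact (ENNReal.ofReal_le_iff_le_toReal (hΦ.volume_fibre_lt_top h.isCompact u).ne).symm
  bounded := by
    obtain ⟨R, hR⟩ := h.isCompact.isBounded.subset_closedBall 0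
    refine ⟨R, fun u hu => ?_⟩
    have : {y : G | Φ (u, y) ∈ K}.Nonempty := by
      by_contra hne
      rw [not_nonempty_iff_eq_empty] at hne
      simp [fibreVolume, vol, hne] at hu
    obtain ⟨y, hy⟩ := this
    exact (hΦ.norm_fst_le u y).trans (by simpa using hR hy)
  integrable := hΦ.integrable_fibreVolume h.isCompact
  rpow_mul_rpow_le u v a b ha hb hab := by
    -- By convexity, the combination of the fibres over `u` and `v` lies in the fibre over `a • u +
    -- b • v`; Brunn–Minkowski in `G` does the rest.
    have := measure_rpow_mul_measure_rpow_le (measurableSet_fibre h.isCompact u)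
      (measurableSet_fibre h.isCompact v) (measurableSet_fibre (Φ := Φ) h.isCompact (a • u + b • v))
      ha hb hab fun x hx y hy => by
        have := h.convex hx hy ha.le hb.le hab
        rwa [← map_smul, ← map_smul, ← map_add] at this
    have h2 := ENNReal.toReal_mono (hΦ.volume_fibre_lt_top h.isCompact _).ne this
    rwa [ENNReal.toReal_mul, ← ENNReal.toReal_rpow, ← ENNReal.toReal_rpow] at h2
  pos_near := by
    obtain ⟨r, hr, hrK⟩ := Metric.isOpen_iff.1 isOpen_interior 0 h.zero_mem_interior
    refine ⟨r / 2, by positivity, fun u hu => ?_⟩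
    refine ENNReal.toReal_pos ?_ (hΦ.volume_fibre_lt_top h.isCompact u).ne
    refine ((measure_ball_pos volume (0 : G) (half_pos hr)).trans_le (measure_mono fun y hy => ?_)).ne'
    refine (interior_subset : interior K ⊆ K) (hrK ?_)
    rw [mem_ball_zero_iff] at hy ⊢
    refine lt_of_pow_lt_pow_left₀ 2 hr.le ?_
    rw [hΦ.norm_sq]
    nlinarith [norm_nonneg u, norm_nonneg y]
  integral_eq_one := by
    have := hΦ.integral_mul_fibreVolume h.isCompact (ψ := fun _ => 1) (φ := fun _ => 1)
      continuous_const fun _ _ => rfl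
    have h1 : volume.real K = 1 := h.vol_eq_one
    simpa [h1] using this
  integral_inner θ := by
    rw [hΦ.integral_mul_fibreVolume h.isCompact (ψ := fun x => inner ℝ (Φ (θ, 0)) x) (by fun_prop)
      fun u y => by simp [hΦ.inner_eq]]
    have hii : IntegrableOn (fun x : E => x) K :=
      continuous_id.continuousOn.integrableOn_compact h.isCompact
    have hint : ∫ x in K, x = 0 := by
      have := h.barycenter_eq_zero
      rwa [h.vol_eq_one, inv_one, one_smul] at this
    have := (innerSL ℝ (Φ (θ, 0))).integral_comp_comm hii
    rw [hint, map_zero] at this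
    exact this
  integral_inner_sq θ hθ := by
    rw [hΦ.integral_mul_fibreVolume h.isCompact (ψ := fun x => inner ℝ x (Φ (θ, 0)) ^ 2) (by fun_prop)
      fun u y => by rw [real_inner_comm]; simp [hΦ.inner_eq]]
    refine h.second_moment _ ?_
    have := hΦ.norm_sq θ 0
    rw [hθ] at this
    rw [mem_sphere_zero_iff_norm, ← sq_eq_sq₀ (norm_nonneg _) zero_le_one, this]
    simp

end IsOrthogonalSplitting

/-- The splitting of `E` into the line spanned by the unit vector `ξ` and the hyperplane `ξ^⊥`. -/
noncomputable def lineSplitting (ξ : E) : ℝ × perp ξ →L[ℝ] E :=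
  (ContinuousLinearMap.toSpanSingleton ℝ ξ).coprod (perp ξ).subtypeL

omit [FiniteDimensional ℝ E] [MeasurableSpace E] [BorelSpace E] in
theorem lineSplitting_apply (ξ : E) (t : ℝ) (y : perp ξ) : lineSplitting ξ (t, y) = t • ξ + y := by
  simp [lineSplitting]

theorem isOrthogonalSplitting_lineSplitting {ξ : E} (hξ : ‖ξ‖ = 1) :
    IsOrthogonalSplitting volume (lineSplitting ξ) where
  measurePreserving := by
    have h1 : MeasurePreserving (LinearIsometryEquiv.toSpanUnitSingleton (𝕜 := ℝ) ξ hξ) :=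
      LinearIsometryEquiv.measurePreserving _
    have h2 := (Submodule.span ℝ {ξ}).orthogonalDecomposition.symm.measurePreserving
    exact (h2.comp (WithLp.volume_preserving_toLp _ _)).comp (h1.prod (.id (volume : Measure (perp ξ))))
  inner_eq p q := by
    obtain ⟨t, y⟩ := p
    obtain ⟨s, z⟩ := q
    have h1 := mem_perp.1 y.2
    have h2 := mem_perp.1 z.2
    rw [lineSplitting_apply, lineSplitting_apply, inner_add_left, inner_add_right, inner_add_right,
      real_inner_smul_left, real_inner_smul_left, real_inner_smul_right, real_inner_smul_right,
      real_inner_self_eq_norm_sq, hξ, real_inner_comm ξ (y : E), h1, h2]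
    simp [mul_comm]

/-- The splitting of `E` into the plane spanned by the orthonormal vectors `ξ`, `η` and its
orthogonal complement. -/
noncomputable def planeSplitting (ξ : E) (η : perp ξ) : ℂ × perp η →L[ℝ] E :=
  lineSplitting ξ ∘L (Complex.reCLM ∘L ContinuousLinearMap.fst ℝ ℂ (perp η)).prod
    (lineSplitting η ∘L Complex.imCLM.prodMap (ContinuousLinearMap.id ℝ (perp η)))

omit [FiniteDimensional ℝ E] [MeasurableSpace E] [BorelSpace E] in
theorem planeSplitting_apply (ξ : E) (η : perp ξ) (z : ℂ) (y : perp η) :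
    planeSplitting ξ η (z, y) = lineSplitting ξ (z.re, lineSplitting η (z.im, y)) := rfl

theorem isOrthogonalSplitting_planeSplitting {ξ : E} (hξ : ‖ξ‖ = 1) {η : perp ξ} (hη : ‖η‖ = 1) :
    IsOrthogonalSplitting volume (planeSplitting ξ η) where
  measurePreserving := by
    have h1 := Complex.volume_preserving_equiv_real_prod.prod (.id (volume : Measure (perp η)))
    have h2 := volume_preserving_prodAssoc (α₁ := ℝ) (β₁ := ℝ) (γ₁ := perp η)
    have h3 := (MeasurePreserving.id (volume : Measure ℝ)).prod
      (isOrthogonalSplitting_lineSplitting hη).measurePreserving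
    exact (isOrthogonalSplitting_lineSplitting hξ).measurePreserving.comp (h3.comp (h2.comp h1))
  inner_eq p q := by
    obtain ⟨z, y⟩ := p
    obtain ⟨w, x⟩ := q
    rw [planeSplitting_apply, planeSplitting_apply,
      (isOrthogonalSplitting_lineSplitting hξ).inner_eq,
      (isOrthogonalSplitting_lineSplitting hη).inner_eq, Complex.inner]
    simp
    ring

theorem vol_sect_eq_fibreVolume (K : Set E) (ξ : E) :
    vol (sect K ξ) = fibreVolume (lineSplitting ξ) K 0 := by
  simp [fibreVolume, lineSplitting_apply, sect]

theorem vol_sect_sect_eq_fibreVolume (K : Set E) (ξ : E) (η : perp ξ) :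
    vol (sect (sect K ξ) η) = fibreVolume (planeSplitting ξ η) K 0 := by
  simp [fibreVolume, planeSplitting_apply, lineSplitting_apply, sect]

/-- The marginal of a marginal is again a marginal of `K`: along `θ` it is the one for the line
through `Φ (θ, 0)`, because both integrals equal the integral over `K` of `φ` composed with the
inner product against `Φ (θ, 0)`. -/
theorem IsIsotropicWith.exists_marginal {μ : Measure F} [SFinite μ] {Φ : F × G →L[ℝ] E}
    (hΦ : IsOrthogonalSplitting μ Φ) {K : Set E} {L : ℝ} (h : IsIsotropicWith K L) (θ : F)
    (hθ : ‖θ‖ = 1) : ∃ f : ℝ → ℝ, IsLogConcaveDensity volume f L ∧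
      ∀ φ : ℝ → ℝ, Continuous φ →
        ∫ t, φ t * f t = ∫ u, φ (inner ℝ θ u) * fibreVolume Φ K u ∂μ := by
  have hn : ‖Φ (θ, 0)‖ = 1 := by
    have := hΦ.norm_sq θ 0
    rw [hθ] at this
    rw [← sq_eq_sq₀ (norm_nonneg _) zero_le_one, this]
    simp
  have hs := isOrthogonalSplitting_lineSplitting hn
  refine ⟨_, hs.isLogConcaveDensity h, fun φ hφ => ?_⟩
  rw [hs.integral_mul_fibreVolume h.isCompact (ψ := fun x => φ (inner ℝ (Φ (θ, 0)) x))
      (hφ.comp (by fun_prop)) fun u y => ?_,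
    hΦ.integral_mul_fibreVolume h.isCompact (ψ := fun x => φ (inner ℝ (Φ (θ, 0)) x))
      (hφ.comp (by fun_prop)) fun u y => ?_]
  · simp [hΦ.inner_eq]
  · rw [lineSplitting_apply, inner_add_right, mem_perp.1 y.2, real_inner_smul_right,
      real_inner_self_eq_norm_sq, hn]
    simp

end Splitting

/-! ### Uniform bounds and the conclusion. -/

/-- The order of quantifiers is the point: the constants are chosen from `F` and `μ` alone, before
`E`, `G` and `K`, hence do not depend on the dimension of the body. -/
theorem exists_bounds_fibreVolume {F : Type*} [NormedAddCommGroup F] [InnerProductSpace ℝ F]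
    [FiniteDimensional ℝ F] [MeasurableSpace F] [BorelSpace F] (μ : Measure F) [μ.IsAddHaarMeasure] :
    ∃ c C : ℝ, 0 < c ∧ 0 < C ∧ ∀ {E G : Type}
      [NormedAddCommGroup G] [InnerProductSpace ℝ G] [FiniteDimensional ℝ G]
      [MeasurableSpace G] [BorelSpace G]
      [NormedAddCommGroup E] [InnerProductSpace ℝ E] [FiniteDimensional ℝ E]
      [MeasurableSpace E] [BorelSpace E] (Φ : F × G →L[ℝ] E), IsOrthogonalSplitting μ Φ →
      ∀ (K : Set E) (L : ℝ), IsIsotropicWith K L →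
        c * (L ^ Module.finrank ℝ F)⁻¹ ≤ fibreVolume Φ K 0 ∧
          fibreVolume Φ K 0 ≤ C * (L ^ Module.finrank ℝ F)⁻¹ := by
  obtain ⟨c, hc, hlow⟩ := IsLogConcaveDensity.exists_pos_le_mul_pow μ
  obtain ⟨C, hC, hup⟩ := IsLogConcaveDensity.exists_mul_pow_le μ
  refine ⟨c, C, hc, hC, ?_⟩
  intro E G _ _ _ _ _ _ _ _ _ _ Φ hΦ K L h
  have hL : 0 < L ^ Module.finrank ℝ F := pow_pos h.pos _
  rw [← div_eq_mul_inv, ← div_eq_mul_inv, div_le_iff₀ hL, le_div_iff₀ hL]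
  exact ⟨hlow _ _ (hΦ.isLogConcaveDensity h),
    hup _ _ (hΦ.isLogConcaveDensity h) (h.exists_marginal hΦ)⟩

theorem mainTheorem10 :
    ∃ c C : ℝ, 0 < c ∧ 0 < C ∧
      (∀ n : ℕ, 1 ≤ n → ∀ (K : Set (EuclideanSpace ℝ (Fin n))) (L : ℝ), IsIsotropicWith K L →
        (c * L⁻¹ ≤ avgSection K ∧ avgSection K ≤ C * L⁻¹) ∧
        (2 ≤ n →
          (∀ ξ ∈ Metric.sphere (0 : EuclideanSpace ℝ (Fin n)) 1,
            c * (L ^ 2)⁻¹ ≤ avgSection (sect K ξ) ∧ avgSection (sect K ξ) ≤ C * (L ^ 2)⁻¹) ∧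
          IsGreatest
            (Set.range fun ξ : Metric.sphere (0 : EuclideanSpace ℝ (Fin n)) 1 =>
              avgSection (sect K (ξ : EuclideanSpace ℝ (Fin n))))
            (maxAvgSection K) ∧
          c * (L * vol K ^ (1 / (n : ℝ)) * maxAvgSection K) ≤ avgSection K ∧
          avgSection K ≤ C * (L * vol K ^ (1 / (n : ℝ)) * maxAvgSection K))) ∧
      (∀ n : ℕ, 2 ≤ n → ∀ γ : ℝ, 0 < γ →
        (∀ K : Set (EuclideanSpace ℝ (Fin n)), IsCenteredConvexBody K →
          avgSection K ≤ γ * vol K ^ (1 / (n : ℝ)) * maxAvgSection K) →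
        ∀ (K : Set (EuclideanSpace ℝ (Fin n))) (L : ℝ), IsIsotropicWith K L → c * L ≤ γ) := by
  obtain ⟨c₁, C₁, hc₁, hC₁, H₁⟩ := exists_bounds_fibreVolume (volume : Measure ℝ)
  -- `ℂ` serves as the Euclidean plane, since `ℝ × ℝ` carries the sup norm.
  obtain ⟨c₂, C₂, hc₂, hC₂, H₂⟩ := exists_bounds_fibreVolume (volume : Measure ℂ)
  simp only [Module.finrank_self, pow_one] at H₁
  simp only [Complex.finrank_real_complex] at H₂
  have hnt : ∀ n : ℕ, 1 ≤ n → Nontrivial (EuclideanSpace ℝ (Fin n)) := fun n hn =>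
    Module.nontrivial_of_finrank_pos (R := ℝ) (by rw [finrank_euclideanSpace_fin]; omega)
  have hntp : ∀ n : ℕ, 2 ≤ n → ∀ ξ : EuclideanSpace ℝ (Fin n), Nontrivial (perp ξ) := fun n hn ξ => by
    refine Module.nontrivial_of_finrank_pos (R := ℝ) ?_
    have h1 := (Submodule.span ℝ {ξ}).finrank_add_finrank_orthogonal
    have h2 := finrank_span_le_card (R := ℝ) ({ξ} : Set (EuclideanSpace ℝ (Fin n)))
    rw [toFinset_singleton, Finset.card_singleton] at h2
    rw [finrank_euclideanSpace_fin] at h1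
    change 0 < Module.finrank ℝ (Submodule.span ℝ {ξ})ᗮ
    omega
  have as₁ : ∀ n : ℕ, 1 ≤ n → ∀ (K : Set (EuclideanSpace ℝ (Fin n))) (L : ℝ), IsIsotropicWith K L →
      c₁ * L⁻¹ ≤ avgSection K ∧ avgSection K ≤ C₁ * L⁻¹ := fun n hn K L h => by
    have := hnt n hn
    refine le_avgSection_and_avgSection_le h.isCompact fun ξ hξ => ?_
    rw [vol_sect_eq_fibreVolume]
    exact H₁ _ (isOrthogonalSplitting_lineSplitting hξ) K L h
  have as₂ : ∀ n : ℕ, 2 ≤ n → ∀ (K : Set (EuclideanSpace ℝ (Fin n))) (L : ℝ), IsIsotropicWith K L →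
      ∀ ξ ∈ Metric.sphere (0 : EuclideanSpace ℝ (Fin n)) 1,
        c₂ * (L ^ 2)⁻¹ ≤ avgSection (sect K ξ) ∧ avgSection (sect K ξ) ≤ C₂ * (L ^ 2)⁻¹ :=
    fun n hn K L h ξ hξ => by
    have := hntp n hn ξ
    refine le_avgSection_and_avgSection_le (isCompact_sect h.isCompact ξ) fun η hη => ?_
    rw [vol_sect_sect_eq_fibreVolume]
    exact H₂ _ (isOrthogonalSplitting_planeSplitting (norm_eq_of_mem_sphere ⟨ξ, hξ⟩) hη) K L h
  have hmax : ∀ n : ℕ, 2 ≤ n → ∀ (K : Set (EuclideanSpace ℝ (Fin n))) (L : ℝ), IsIsotropicWith K L →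
      IsGreatest (Set.range fun ξ : Metric.sphere (0 : EuclideanSpace ℝ (Fin n)) 1 =>
        avgSection (sect K (ξ : EuclideanSpace ℝ (Fin n)))) (maxAvgSection K) ∧
      c₂ * (L ^ 2)⁻¹ ≤ maxAvgSection K ∧ maxAvgSection K ≤ C₂ * (L ^ 2)⁻¹ := fun n hn K L h => by
    have := hnt n (by omega)
    have hg := isGreatest_maxAvgSection h.isCompact fun ξ => hntp n hn ξ
    refine ⟨hg, ?_⟩
    obtain ⟨ξ, hξ⟩ := hg.1
    rw [← hξ]
    exact as₂ n hn K L h ξ ξ.2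
  -- The quotients `c₁ / C₂` and `C₁ / c₂` come from comparing `L⁻¹` with `L * (L ^ 2)⁻¹` in (iii);
  -- `c₁ / C₂` also serves (iv).
  refine ⟨min c₁ (min c₂ (c₁ / C₂)), max C₁ (max C₂ (C₁ / c₂)),
    lt_min hc₁ (lt_min hc₂ (by positivity)), lt_max_of_lt_left hC₁, ?_, ?_⟩
  · intro n hn K L h
    have hL := h.pos
    have ha := as₁ n hn K L h
    refine ⟨⟨le_trans ?_ ha.1, ha.2.trans ?_⟩, fun hn2 => ⟨fun ξ hξ => ⟨le_trans ?_
      (as₂ n hn2 K L h ξ hξ).1, (as₂ n hn2 K L h ξ hξ).2.trans ?_⟩, (hmax n hn2 K L h).1, ?_, ?_⟩⟩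
    · gcongr; exact min_le_left _ _
    · gcongr; exact le_max_left _ _
    · gcongr; exact (min_le_right _ _).trans (min_le_left _ _)
    · gcongr; exact (le_max_left _ _).trans (le_max_right _ _)
    · rw [h.vol_eq_one, Real.one_rpow, mul_one]
      have hm := (hmax n hn2 K L h).2
      have hm0 : 0 ≤ maxAvgSection K := le_trans (by positivity) hm.1
      calc _ ≤ c₁ / C₂ * (L * (C₂ * (L ^ 2)⁻¹)) := by
            gcongr
            · exact (min_le_right _ _).trans (min_le_right _ _)
            · exact hm.2
        _ = c₁ * L⁻¹ := by field_simp
        _ ≤ _ := ha.1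
    · rw [h.vol_eq_one, Real.one_rpow, mul_one]
      have hm := (hmax n hn2 K L h).2
      calc _ ≤ C₁ * L⁻¹ := ha.2
        _ = C₁ / c₂ * (L * (c₂ * (L ^ 2)⁻¹)) := by field_simp
        _ ≤ _ := by
            gcongr
            · exact (le_max_right _ _).trans (le_max_right _ _)
            · exact hm.1
  · intro n hn γ hγ H K L h
    have hL := h.pos
    have h1 := H K h.toIsCenteredConvexBody
    rw [h.vol_eq_one, Real.one_rpow, mul_one] at h1
    -- Testing the assumed inequality on the isotropic body itself: its left side is at least of
    -- order `L⁻¹`, its right side at most of order `γ * L⁻²`.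
    have h2 : c₁ * L⁻¹ ≤ γ * (C₂ * (L ^ 2)⁻¹) :=
      (as₁ n (by omega) K L h).1.trans (h1.trans (by gcongr; exact (hmax n hn K L h).2.2))
    have h3 : c₁ / C₂ * L ≤ γ := by
      have := mul_le_mul_of_nonneg_right h2 (show 0 ≤ L ^ 2 / C₂ by positivity)
      have e1 : c₁ * L⁻¹ * (L ^ 2 / C₂) = c₁ / C₂ * L := by field_simp
      have e2 : γ * (C₂ * (L ^ 2)⁻¹) * (L ^ 2 / C₂) = γ := by field_simp
      rwa [e1, e2] at this
    refine le_trans ?_ h3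
    gcongr
    exact (min_le_right _ _).trans (min_le_right _ _)
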